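/- Let $d\ge 2$ and consider critical Bernoulli bond percolation $\mathbb P_{p_c}$ on the nearest-neighbour lattice $\mathbb Z^d$, where $p_c=\sup\{p\in[0,1]:\mathbb P_p(0\leftrightarrow\infty)=0\}$. Write $\Lambda_n=\{-n,\dots,n\}^d$, let $\partial A$ be the outer vertex boundary of $A\subseteq\mathbb Z^d$, and let $A\leftrightarrow B$ mean that some vertex of $A$ is joined to some vertex of $B$ by an open path. Put $\pi(m,n)=\mathbb P_{p_c}(\partial\Lambda_m\leftrightarrow\partial\Lambda_n)$ for integers $m,n\ge 0$, $\pi(x)=\pi(1,\lfloor x\rfloor)$ for real $x\ge0$, and $\mathcal V_n=\{v\in\Lambda_n: v\leftrightarrow\partial\Lambda_{2n}\}$. Suppose that (I) (quasi-multiplicativity) $\pi(k,l)\,\pi(l,m)\le C_1\,\pi(k,m)$ for all integers $0\le k\le l\le m$; (II) (one-arm exponent bound) $\pi(n)/\pi(m)\ge C_2\,(n/m)^{-\alpha}$ for all integers $n\ge m\ge 1$, where $C_2>0$ and $\alpha<d$. Then there are constants $c_1,c_2,c_3,c_4>0$, depending only on $d,C_1,C_2,\alpha$, such that: (a) for all integers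 $n,k\ge 1$, $$\mathbb E_{p_c}\binom{|\mathcal V_n|}{k}\le\left(\frac{c_1\,n^d\,\pi(n/k^{1/d})}{k}\right)^{k};$$ (b) for all integers $n\ge1$ and real $0<u\le n$, $$\mathbb P_{p_c}\left(|\mathcal V_n|\ge c_4\,n^d\,\pi(n/u)\right)\le c_2\exp(-c_3u^d).$$ (c) If in addition the one-arm probability decays, in the sense that $\pi(Lm)\le q\,\pi(m)$ for all integers $m\ge1$, for some integer $L\ge2$ and some $q<1$, then $$\mathbb P_{p_c}\left(|\mathcal V_n|\ge n^d\,\pi(n/u)\right)\le c_2'\exp(-c_3'u^d)$$ for all integers $n\ge1$ and real $0<u\le n$, with constants $c_2',c_3'>0$ depending only on $d,C_1,C_2,\alpha,L,q$. -/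

import Mathlib

open MeasureTheory ProbabilityTheory

noncomputable section

namespace BondPercolation

/-- The nearest-neighbour graph on the hypercubic lattice `ℤᵈ`: two sites are adjacent when their
`ℓ¹`-distance is `1`. -/
def lattice (d : ℕ) : SimpleGraph (Fin d → ℤ) where
  Adj u v := ∑ i, |u i - v i| = 1
  symm := ⟨fun u v h => by simpa only [abs_sub_comm] using h⟩
  loopless := ⟨fun u h => by simp at h⟩

/-- Configurations: every edge of `ℤᵈ` is open (`true`) or closed (`false`). -/
abbrev Config (d : ℕ) : Type := (lattice d).edgeSet → Bool

/-- The product measure `P_p`: edges are open with probability `p`, independently. -/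
def perc (d : ℕ) (p : unitInterval) : Measure (Config d) :=
  Measure.infinitePi fun _ : (lattice d).edgeSet => bernoulliMeasure true false p

/-- The subgraph of `ℤᵈ` formed by the open edges. -/
def openGraph {d : ℕ} (ω : Config d) : SimpleGraph (Fin d → ℤ) where
  Adj u v := ∃ h : (lattice d).Adj u v, ω ⟨s(u, v), h⟩ = true
  symm := ⟨by
    rintro u v ⟨h, ho⟩
    refine ⟨h.symm, ?_⟩
    have e : (⟨s(v, u), h.symm⟩ : (lattice d).edgeSet) = ⟨s(u, v), h⟩ :=
      Subtype.ext Sym2.eq_swap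
    rw [e]
    exact ho⟩
  loopless := ⟨fun u ⟨h, _⟩ => (lattice d).loopless.irrefl u h⟩

/-- `A ↔ B`: some vertex of `A` is joined to some vertex of `B` by an open path. -/
def Connected {d : ℕ} (ω : Config d) (A B : Set (Fin d → ℤ)) : Prop :=
  ∃ v ∈ A, ∃ w ∈ B, (openGraph ω).Reachable v w

/-- `θ(p) = P_p(0 ↔ ∞)`: the probability that the open cluster of the origin is infinite. -/
def theta (d : ℕ) (p : unitInterval) : ℝ :=
  (perc d p).real {ω | {v | (openGraph ω).Reachable 0 v}.Infinite}

/-- The critical parameter `p_c(d) = sup {p ∈ [0, 1] : P_p(0 ↔ ∞) = 0}`, the supremum being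
taken in the complete lattice `[0, 1]`. -/
def pc (d : ℕ) : unitInterval := sSup {p | theta d p = 0}

/-- Critical bond percolation. -/
def critical (d : ℕ) : Measure (Config d) := perc d (pc d)

/-- The box `Λ_n = {-n, …, n}ᵈ`. -/
def box (d n : ℕ) : Set (Fin d → ℤ) := {v | ∀ i, |v i| ≤ (n : ℤ)}

/-- The outer vertex boundary `∂A`. -/
def boundary {d : ℕ} (A : Set (Fin d → ℤ)) : Set (Fin d → ℤ) :=
  {v | v ∉ A ∧ ∃ u ∈ A, (lattice d).Adj u v}

/-- `π(m, n) = P_{p_c}(∂Λ_m ↔ ∂Λ_n)`. -/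
def arm₂ (d m n : ℕ) : ℝ :=
  (critical d).real {ω | Connected ω (boundary (box d m)) (boundary (box d n))}

/-- `π(x) = π(1, ⌊x⌋)`; the box of real radius `x ≥ 0` in `ℤᵈ` is the box of radius `⌊x⌋`. -/
def arm (d : ℕ) (x : ℝ) : ℝ := arm₂ d 1 ⌊x⌋₊

/-- The set `V_n` of vertices of `Λ_n` that are connected to `∂Λ_{2n}`. -/
def V (d n : ℕ) (ω : Config d) : Set (Fin d → ℤ) :=
  {v | v ∈ box d n ∧ Connected ω {v} (boundary (box d (2 * n)))}

/-- Quasi-multiplicativity with constant `C₁`. -/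
def QuasiMultiplicative (d : ℕ) (C₁ : ℝ) : Prop :=
  ∀ k l m : ℕ, k ≤ l → l ≤ m → arm₂ d k l * arm₂ d l m ≤ C₁ * arm₂ d k m

/-- The one-arm exponent bound: `π(n) / π(m) ≥ C₂ (n / m) ^ (-α)` for `n ≥ m ≥ 1`. -/
def OneArmLowerBound (d : ℕ) (C₂ α : ℝ) : Prop :=
  ∀ m n : ℕ, 1 ≤ m → m ≤ n → C₂ * ((n : ℝ) / m) ^ (-α) ≤ arm d n / arm d m

/-- The one-arm probability drops by a fixed factor `q` whenever the scale is multiplied by `L`. -/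
def OneArmDecay (d L : ℕ) (q : ℝ) : Prop :=
  ∀ m : ℕ, 1 ≤ m → arm d ((L * m : ℕ) : ℝ) ≤ q * arm d m

end BondPercolation

end

/-!
The tail of `|V_n|` on the scale `n ^ d π(n / u)` is governed by
boxes of radius `r ≈ n / u`: a vertex of `Λ_n` joined to `∂Λ_{2n}` is joined out of the box of
radius `2r` concentric with the box of radius `r` containing it. The boxes of radius `r` form
`2 ^ d` parity classes, and within a class the contributions are independent copies of `|V_r|`.
Hence (`genFun_le_genFun_pow`), with the arithmetic-geometric mean inequality over the classes,
`E (1 + s) ^ |V_n| ≤ (E (1 + 2 ^ 2 ^ d s) ^ |V_r|) ^ N`, where `N ≈ (n / r) ^ d` is the number of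
boxes. Everything therefore follows from the uniform exponential moment bound
`E (1 + θ / μ_n) ^ |V_n| ≤ 2`, where `μ_n = n ^ d π(n)` (`ArmBounds.exists_genFun_le_two`): part (a)
takes `r ≈ n / k ^ (1 / d)` and bounds `binom(|V_n|, k)` by `s ^ (-k) (1 + s) ^ |V_n|`, part (b) is
Chernoff's bound with `r ≈ n / u`, and part (c) is part (b) at the scale `L ^ j n / u`, where decay
absorbs the constant.

The exponential moment bound is proved by the same decomposition with `r = n / K` for a large
constant `K`. Because `μ_r / μ_n ≤ const · K ^ (-(d - α))` and `α < d`, passing from scale `r` to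
scale `n` at least halves the parameter `s`, so that the terms of order above `m` in the expansion
of `(1 + s / 2) ^ |V_r|` shrink by `2 ^ (-m)`; for `m` large this beats the bounded number of boxes.
The terms of order at most `m` only require, for each fixed `k`, the bound
`E binom(|V_n|, k) ≤ const(k) μ_n ^ k`, with no uniformity in `k`
(`ArmBounds.integral_choose_le`).

The fixed-order moments are sums over `k`-point sets `S` of the probability that all points of `S`
have long arms. Let `t` be the smallest scale at which `S` is connected. Then `S` splits into two
parts `A` and `B` at distance `t`, each connected at scale `t` (`Linked.exists_split`). The arms of
length `t / 2` from `A` and from `B`, and one arm from scale `t` to scale `n`, use disjoint edges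
and are independent. Quasi-multiplicativity bounds the probability of the last one by a constant
times `π(n) / π(t)` (`ArmBounds.measureReal_allReach_union_le`). Summing over `t`, the two parts
and the pair of points realising the gap gives an induction on `k` (`ArmBounds.sum_linkedSets_le`), and the
sum over `t` is dominated by the largest scale because `α < d`.
-/

noncomputable section

namespace BondPercolation

variable {d : ℕ}

/-! ### Functions of finitely many edges -/

instance (p : unitInterval) : IsProbabilityMeasure (perc d p) := by
  unfold perc; infer_instance

instance : IsProbabilityMeasure (critical d) := by
  unfold critical; infer_instance

/-- A function of finitely many edges factors through the restriction to these edges. -/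
lemma exists_eq_comp_restrict {β : Type*} {f : Config d → β} {F : Finset (lattice d).edgeSet}
    (hf : DependsOn f (F : Set (lattice d).edgeSet)) :
    ∃ g : (F → Bool) → β, f = g ∘ F.restrict := by
  classical
  refine ⟨fun y => f fun e => if h : e ∈ F then y ⟨e, h⟩ else false, funext fun ω => ?_⟩
  refine hf fun e he => ?_
  have he' : e ∈ F := he
  simp [he', Finset.restrict]

lemma measurable_of_dependsOn {β : Type*} [MeasurableSpace β] {f : Config d → β}
    {F : Finset (lattice d).edgeSet} (hf : DependsOn f (F : Set (lattice d).edgeSet)) :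
    Measurable f := by
  obtain ⟨g, rfl⟩ := exists_eq_comp_restrict hf
  exact (measurable_of_countable g).comp (Finset.measurable_restrict F)

lemma integrable_of_dependsOn {f : Config d → ℝ} {F : Finset (lattice d).edgeSet}
    (hf : DependsOn f (F : Set (lattice d).edgeSet)) (μ : Measure (Config d)) [IsFiniteMeasure μ] :
    Integrable f μ := by
  have hm := measurable_of_dependsOn hf
  obtain ⟨g, rfl⟩ := exists_eq_comp_restrict hf
  obtain ⟨C, hC⟩ := (Set.finite_range fun y => ‖g y‖).bddAbove
  exact Integrable.of_bound hm.aestronglyMeasurable C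
    (Filter.Eventually.of_forall fun ω => hC ⟨_, rfl⟩)

/-- Functions of disjoint finite sets of edges are independent. -/
lemma integral_mul_of_dependsOn {f g : Config d → ℝ} {F G : Finset (lattice d).edgeSet}
    (hf : DependsOn f (F : Set (lattice d).edgeSet))
    (hg : DependsOn g (G : Set (lattice d).edgeSet)) (hFG : Disjoint F G) (p : unitInterval) :
    ∫ ω, f ω * g ω ∂(perc d p) = (∫ ω, f ω ∂(perc d p)) * ∫ ω, g ω ∂(perc d p) := by
  have hmf := measurable_of_dependsOn hf
  have hmg := measurable_of_dependsOn hg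
  obtain ⟨f', rfl⟩ := exists_eq_comp_restrict hf
  obtain ⟨g', rfl⟩ := exists_eq_comp_restrict hg
  have h1 : iIndepFun (fun (e : (lattice d).edgeSet) (ω : Config d) => ω e) (perc d p) :=
    iIndepFun_infinitePi (P := fun _ : (lattice d).edgeSet => bernoulliMeasure true false p)
      (X := fun _ b => b) (fun _ => measurable_id)
  have h2 := h1.indepFun_finset F G hFG (fun e => measurable_pi_apply e)
  have h3 := h2.comp (measurable_of_countable f') (measurable_of_countable g')
  exact h3.integral_mul_eq_mul_integral hmf.aestronglyMeasurable hmg.aestronglyMeasurable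

lemma DependsOn.finset_prod {ι : Type*} {s : Finset ι} {f : ι → Config d → ℝ}
    {F : ι → Set (lattice d).edgeSet} (hf : ∀ i ∈ s, DependsOn (f i) (F i)) :
    DependsOn (fun ω => ∏ i ∈ s, f i ω) (⋃ i ∈ s, F i) := by
  intro x y hxy
  refine Finset.prod_congr rfl fun i hi => hf i hi fun e he => hxy e ?_
  exact Set.mem_biUnion hi he

lemma integral_prod_of_dependsOn {ι : Type*} {s : Finset ι} {f : ι → Config d → ℝ}
    {F : ι → Finset (lattice d).edgeSet}
    (hf : ∀ i ∈ s, DependsOn (f i) (F i : Set (lattice d).edgeSet))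
    (hF : (s : Set ι).PairwiseDisjoint F) (p : unitInterval) :
    ∫ ω, ∏ i ∈ s, f i ω ∂(perc d p) = ∏ i ∈ s, ∫ ω, f i ω ∂(perc d p) := by
  classical
  induction s using Finset.induction_on with
  | empty => simp
  | insert a s ha ih =>
    simp only [Finset.prod_insert ha]
    rw [← ih (fun i hi => hf i (Finset.mem_insert_of_mem hi))
      (hF.subset (by simp))]
    refine integral_mul_of_dependsOn (hf a (Finset.mem_insert_self a s)) (G := s.biUnion F) ?_ ?_ p
    · rw [Finset.coe_biUnion]
      exact DependsOn.finset_prod fun i hi => hf i (Finset.mem_insert_of_mem hi)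
    · rw [Finset.disjoint_biUnion_right]
      intro i hi
      refine hF (by simp) (by simp [hi]) ?_
      rintro rfl
      exact ha hi

lemma measurableSet_of_dependsOn {P : Config d → Prop} {F : Finset (lattice d).edgeSet}
    (hP : DependsOn P (F : Set (lattice d).edgeSet)) : MeasurableSet {ω | P ω} :=
  measurableSet_setOfPred.2 (measurable_of_dependsOn hP)

lemma measureReal_and_of_dependsOn {P Q : Config d → Prop} {F G : Finset (lattice d).edgeSet}
    (hP : DependsOn P (F : Set (lattice d).edgeSet))
    (hQ : DependsOn Q (G : Set (lattice d).edgeSet)) (hFG : Disjoint F G) (p : unitInterval) :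
    (perc d p).real {ω | P ω ∧ Q ω} = (perc d p).real {ω | P ω} * (perc d p).real {ω | Q ω} := by
  have ind : ∀ {R : Config d → Prop} {S : Set (lattice d).edgeSet}, DependsOn R S →
      DependsOn ({ω | R ω}.indicator (1 : Config d → ℝ)) S := by
    intro R S hR x y h
    have : x ∈ {ω | R ω} ↔ y ∈ {ω | R ω} := iff_of_eq (hR h)
    by_cases hx : x ∈ {ω | R ω}
    · rw [Set.indicator_of_mem hx, Set.indicator_of_mem (this.1 hx), Pi.one_apply, Pi.one_apply]
    · rw [Set.indicator_of_notMem hx, Set.indicator_of_notMem (fun h => hx (this.2 h))]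
  have h3 := integral_mul_of_dependsOn (ind hP) (ind hQ) hFG p
  rw [integral_indicator_one (measurableSet_of_dependsOn hP),
    integral_indicator_one (measurableSet_of_dependsOn hQ)] at h3
  have e : {ω | P ω ∧ Q ω} = {ω | P ω} ∩ {ω | Q ω} := rfl
  rw [← h3, e, ← integral_indicator_one
    ((measurableSet_of_dependsOn hP).inter (measurableSet_of_dependsOn hQ))]
  congr 1
  ext ω
  rw [Set.inter_indicator_one]
  rfl

/-! ### Translation invariance -/

/-- Translation by `z`, as a permutation of the edges. -/
def shiftEdge (z : Fin d → ℤ) : (lattice d).edgeSet ≃ (lattice d).edgeSet :=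
  SimpleGraph.Iso.mapEdgeSet
    (RelIso.mk (Equiv.addRight z) (by intro u v; simp [lattice]) : lattice d ≃g lattice d)

/-- Translation of configurations: the edge `e` is open in `shift z ω` when `e + z` is open
in `ω`. -/
def shift (z : Fin d → ℤ) : Config d ≃ᵐ Config d :=
  (MeasurableEquiv.piCongrLeft (fun _ : (lattice d).edgeSet => Bool) (shiftEdge z)).symm

lemma measurePreserving_shift (z : Fin d → ℤ) (p : unitInterval) :
    MeasurePreserving (shift z) (perc d p) (perc d p) := by
  have h : MeasurePreserving
      (MeasurableEquiv.piCongrLeft (fun _ : (lattice d).edgeSet => Bool) (shiftEdge z))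
      (perc d p) (perc d p) :=
    ⟨MeasurableEquiv.measurable _, Measure.infinitePi_map_piCongrLeft
      (μ := fun _ : (lattice d).edgeSet => bernoulliMeasure true false p) (shiftEdge z)⟩
  exact h.symm

lemma openGraph_shift_adj (z : Fin d → ℤ) (ω : Config d) (u v : Fin d → ℤ) :
    (openGraph (shift z ω)).Adj u v ↔ (openGraph ω).Adj (u + z) (v + z) := by
  constructor
  · rintro ⟨h, ho⟩
    have h' : (lattice d).Adj (u + z) (v + z) := by simpa [lattice] using h
    exact ⟨h', ho⟩
  · rintro ⟨h, ho⟩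
    have h' : (lattice d).Adj u v := by simpa [lattice] using h
    exact ⟨h', ho⟩

lemma openGraph_shift_reachable (z : Fin d → ℤ) (ω : Config d) (u v : Fin d → ℤ) :
    (openGraph (shift z ω)).Reachable u v ↔ (openGraph ω).Reachable (u + z) (v + z) := by
  exact (SimpleGraph.Iso.reachable_iff (φ := (RelIso.mk (Equiv.addRight z) (by
    intro u v; exact (openGraph_shift_adj z ω u v).symm) :
      openGraph (shift z ω) ≃g openGraph ω)) (u := u) (v := v)).symm

lemma measureReal_shift (z : Fin d → ℤ) (p : unitInterval) (P : Config d → Prop) :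
    (perc d p).real {ω | P (shift z ω)} = (perc d p).real {ω | P ω} := by
  have := (measurePreserving_shift z p).measure_preimage_equiv {ω | P ω}
  simp only [measureReal_def]
  rw [← this]
  rfl

lemma integral_shift (z : Fin d → ℤ) (p : unitInterval) (f : Config d → ℝ) :
    ∫ ω, f (shift z ω) ∂(perc d p) = ∫ ω, f ω ∂(perc d p) :=
  (measurePreserving_shift z p).integral_comp' f

/-! ### Supremum norm and boxes -/

/-- The supremum norm on `ℤᵈ`, with values in `ℕ`. -/
def supNorm (v : Fin d → ℤ) : ℕ := Finset.univ.sup fun i => (v i).natAbs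

lemma supNorm_le_iff {v : Fin d → ℤ} {n : ℕ} : supNorm v ≤ n ↔ ∀ i, (v i).natAbs ≤ n := by
  simp [supNorm]

lemma natAbs_le_supNorm (v : Fin d → ℤ) (i : Fin d) : (v i).natAbs ≤ supNorm v :=
  supNorm_le_iff.1 le_rfl i

lemma supNorm_add_le (u v : Fin d → ℤ) : supNorm (u + v) ≤ supNorm u + supNorm v := by
  rw [supNorm_le_iff]
  intro i
  have h1 := natAbs_le_supNorm u i
  have h2 := natAbs_le_supNorm v i
  have h3 := Int.natAbs_add_le (u i) (v i)
  simp only [Pi.add_apply]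
  omega

lemma supNorm_neg (v : Fin d → ℤ) : supNorm (-v) = supNorm v := by
  simp [supNorm]

lemma supNorm_zero : supNorm (0 : Fin d → ℤ) = 0 :=
  Nat.le_zero.1 (supNorm_le_iff.2 fun i => by simp)

lemma supNorm_sub_comm (u v : Fin d → ℤ) : supNorm (u - v) = supNorm (v - u) := by
  rw [← supNorm_neg, neg_sub]

lemma supNorm_sub_le (u v w : Fin d → ℤ) :
    supNorm (u - w) ≤ supNorm (u - v) + supNorm (v - w) := by
  have := supNorm_add_le (u - v) (v - w)
  rwa [sub_add_sub_cancel] at this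

lemma supNorm_eq_zero_iff {v : Fin d → ℤ} : supNorm v = 0 ↔ v = 0 := by
  constructor
  · intro h
    ext i
    have := natAbs_le_supNorm v i
    simp only [Pi.zero_apply]
    omega
  · rintro rfl
    exact supNorm_zero

lemma supNorm_le_one_of_adj {u v : Fin d → ℤ} (h : (lattice d).Adj u v) :
    supNorm (u - v) ≤ 1 := by
  rw [supNorm_le_iff]
  intro i
  have h1 : |u i - v i| ≤ ∑ j, |u j - v j| :=
    Finset.single_le_sum (f := fun j => |u j - v j|) (fun _ _ => abs_nonneg _) (Finset.mem_univ i)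
  have h2 : ∑ j, |u j - v j| = 1 := h
  rw [h2] at h1
  simp only [Pi.sub_apply]
  zify
  exact h1

/-- The box of radius `n` around `z`. -/
def ball (z : Fin d → ℤ) (n : ℕ) : Finset (Fin d → ℤ) :=
  Finset.Icc (fun i => z i - n) (fun i => z i + n)

lemma mem_ball {z v : Fin d → ℤ} {n : ℕ} : v ∈ ball z n ↔ supNorm (v - z) ≤ n := by
  rw [ball, Finset.mem_Icc, supNorm_le_iff, Pi.le_def, Pi.le_def, ← forall_and]
  refine forall_congr' fun i => ?_
  simp only [Pi.sub_apply]
  omega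

lemma mem_ball_self (z : Fin d → ℤ) (n : ℕ) : z ∈ ball z n := by
  simp [mem_ball, supNorm_zero]

lemma card_ball (z : Fin d → ℤ) (n : ℕ) : (ball z n).card = (2 * n + 1) ^ d := by
  rw [ball, Pi.card_Icc]
  simp only [Int.card_Icc]
  rw [Finset.prod_congr rfl (g := fun _ => 2 * n + 1) (fun i _ => by omega)]
  simp

lemma coe_ball_zero (n : ℕ) : (ball (0 : Fin d → ℤ) n : Set (Fin d → ℤ)) = box d n := by
  ext v
  rw [Finset.mem_coe, mem_ball, sub_zero, supNorm_le_iff]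
  refine forall_congr' fun i => ?_
  rw [Int.abs_eq_natAbs]
  omega

/-- The sphere of radius `t ≥ 1` around `a` has at most `2d (2t + 1) ^ (d - 1)` points. -/
lemma card_filter_supNorm_eq_le (W : Finset (Fin d → ℤ)) (a : Fin d → ℤ) {t : ℕ} (ht : 1 ≤ t) :
    (((W.filter fun b => supNorm (b - a) = t).card : ℕ) : ℝ) ≤
      2 * d * (2 * t + 1 : ℝ) ^ (d - 1) := by
  have h1 : (W.filter fun b => supNorm (b - a) = t) ⊆ ball a t \ ball a (t - 1) := by
    intro b hb
    have := (Finset.mem_filter.1 hb).2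
    rw [Finset.mem_sdiff, mem_ball, mem_ball]
    omega
  have h2 := Finset.card_le_card h1
  have h3 : ball a (t - 1) ⊆ ball a t := fun b hb => by
    rw [mem_ball] at *; omega
  rw [Finset.card_sdiff_of_subset h3, card_ball, card_ball] at h2
  have h4 : ((2 * t + 1 : ℝ)) ^ d - (2 * t - 1 : ℝ) ^ d ≤ 2 * d * (2 * t + 1 : ℝ) ^ (d - 1) := by
    have ht' : (1 : ℝ) ≤ t := by exact_mod_cast ht
    have h := (le_abs_self _).trans (abs_pow_sub_pow_le (2 * t + 1 : ℝ) (2 * t - 1) d)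
    rw [abs_of_nonneg (by linarith : (0 : ℝ) ≤ 2 * t + 1),
      abs_of_nonneg (by linarith : (0 : ℝ) ≤ 2 * t - 1),
      max_eq_left (by linarith : (2 * t - 1 : ℝ) ≤ 2 * t + 1),
      abs_of_nonneg (by linarith : (0 : ℝ) ≤ 2 * t + 1 - (2 * t - 1))] at h
    refine h.trans_eq ?_
    ring
  have h5 : (2 * (t - 1) + 1) ^ d ≤ (2 * t + 1) ^ d := Nat.pow_le_pow_left (by omega) d
  have h6 : ((2 * (t - 1) + 1 : ℕ) : ℝ) = 2 * t - 1 := by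
    have : 2 * (t - 1) + 1 = 2 * t - 1 := by omega
    rw [this, Nat.cast_sub (by omega)]
    push_cast; ring
  calc _ ≤ (((2 * t + 1) ^ d - (2 * (t - 1) + 1) ^ d : ℕ) : ℝ) := by exact_mod_cast h2
    _ = (2 * t + 1 : ℝ) ^ d - (2 * t - 1 : ℝ) ^ d := by
      rw [Nat.cast_sub h5, Nat.cast_pow, Nat.cast_pow, h6]
      push_cast; ring
    _ ≤ _ := h4

/-! ### Exit from a finite set through its edges -/

/-- The edges with at least one endpoint in `A`. -/
def touch (A : Set (Fin d → ℤ)) : Set (lattice d).edgeSet :=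
  {e | ∃ v ∈ A, v ∈ (e : Sym2 (Fin d → ℤ))}

lemma mk_mem_touch {A : Set (Fin d → ℤ)} {u v : Fin d → ℤ} (h : (lattice d).Adj u v) :
    (⟨s(u, v), h⟩ : (lattice d).edgeSet) ∈ touch A ↔ u ∈ A ∨ v ∈ A := by
  constructor
  · rintro ⟨w, hw, hw'⟩
    rcases Sym2.mem_iff.1 hw' with rfl | rfl
    · exact Or.inl hw
    · exact Or.inr hw
  · rintro (h | h)
    · exact ⟨u, h, Sym2.mem_mk_left u v⟩
    · exact ⟨v, h, Sym2.mem_mk_right u v⟩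

lemma finite_touch {A : Set (Fin d → ℤ)} (hA : A.Finite) : (touch A).Finite := by
  refine Set.Finite.of_finite_image (f := Subtype.val) (Set.Finite.subset
    (hA.biUnion fun v _ => ((ball v 1).finite_toSet.image fun w => s(v, w))) ?_)
    Subtype.val_injective.injOn
  rintro _ ⟨⟨e, he⟩, ⟨v, hv, hve⟩, rfl⟩
  obtain ⟨w, rfl⟩ := Sym2.mem_iff_exists.1 hve
  refine Set.mem_biUnion hv ⟨w, ?_, rfl⟩
  rw [Finset.mem_coe, mem_ball, supNorm_sub_comm]
  exact supNorm_le_one_of_adj he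

/-- No edge touches two sets at distance at least `2`, since the endpoints of an edge are at
distance `1`. -/
lemma disjoint_touch {A B : Set (Fin d → ℤ)}
    (h : ∀ u ∈ A, ∀ v ∈ B, 2 ≤ supNorm (u - v)) : Disjoint (touch A) (touch B) := by
  rw [Set.disjoint_left]
  rintro ⟨e, he⟩ ⟨u, hu, hue⟩ ⟨v, hv, hve⟩
  have h2 := h u hu v hv
  have hne : u ≠ v := by
    rintro rfl
    rw [sub_self, supNorm_zero] at h2
    omega
  have : e = s(u, v) := (Sym2.mem_and_mem_iff hne).1 ⟨hue, hve⟩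
  subst this
  have h3 : supNorm (u - v) ≤ 1 := supNorm_le_one_of_adj he
  omega

/-- The configuration in which all edges outside `F` have been closed. -/
def mask (F : Set (lattice d).edgeSet) (ω : Config d) : Config d :=
  open Classical in fun e => if e ∈ F then ω e else false

lemma dependsOn_mask {β : Type*} (F : Set (lattice d).edgeSet) (f : Config d → β) :
    DependsOn (fun ω => f (mask F ω)) F := by
  intro x y h
  have : mask F x = mask F y := by
    ext e
    by_cases he : e ∈ F <;> simp [mask, he, h]
  simp only [this]

lemma openGraph_mask_adj {F : Set (lattice d).edgeSet} {ω : Config d} {u v : Fin d → ℤ} :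
    (openGraph (mask F ω)).Adj u v ↔
      ∃ h : (lattice d).Adj u v,
        ω ⟨s(u, v), h⟩ = true ∧ (⟨s(u, v), h⟩ : (lattice d).edgeSet) ∈ F := by
  refine exists_congr fun h => ?_
  by_cases he : (⟨s(u, v), h⟩ : (lattice d).edgeSet) ∈ F <;> simp [mask, he]

lemma mask_mask (F G : Set (lattice d).edgeSet) (ω : Config d) :
    mask F (mask G ω) = mask (F ∩ G) ω := by
  ext e
  by_cases h1 : e ∈ F <;> by_cases h2 : e ∈ G <;> simp [mask, h1, h2]

lemma openGraph_mask_le (F : Set (lattice d).edgeSet) (ω : Config d) :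
    openGraph (mask F ω) ≤ openGraph ω := fun _ _ h =>
  let ⟨h1, h2, _⟩ := openGraph_mask_adj.1 h
  ⟨h1, h2⟩

/-- An open path leaving `A` reaches `∂A` through edges that touch `A`. -/
lemma exists_reachable_boundary_inside {A : Set (Fin d → ℤ)} {ω : Config d} {u w : Fin d → ℤ}
    (hu : u ∈ A) (hw : w ∉ A) (h : (openGraph ω).Reachable u w) :
    ∃ v ∈ boundary A, (openGraph (mask (touch A) ω)).Reachable u v := by
  obtain ⟨p⟩ := h
  induction p with
  | nil => exact absurd hu hw
  | @cons u u' w h p ih =>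
    obtain ⟨hl, ho⟩ := h
    have hadj : (openGraph (mask (touch A) ω)).Adj u u' :=
      openGraph_mask_adj.2 ⟨hl, ho, (mk_mem_touch hl).2 (Or.inl hu)⟩
    by_cases hu' : u' ∈ A
    · obtain ⟨v, hv, hr⟩ := ih hu' hw
      exact ⟨v, hv, hadj.reachable.trans hr⟩
    · exact ⟨u', ⟨hu', u, hu, hl⟩, hadj.reachable⟩

/-- After its last visit to `A`, an open path leaving `A` runs from `∂A` to its endpoint through
edges that do not touch `A`. -/
lemma exists_reachable_boundary_outside {A : Set (Fin d → ℤ)} {ω : Config d} {u w : Fin d → ℤ}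
    (hu : u ∈ A) (hw : w ∉ A) (h : (openGraph ω).Reachable u w) :
    ∃ v ∈ boundary A, (openGraph (mask (touch A)ᶜ ω)).Reachable v w := by
  have key : (∃ v ∈ boundary A, (openGraph (mask (touch A)ᶜ ω)).Reachable v w) ∨
      (u ∉ A ∧ (openGraph (mask (touch A)ᶜ ω)).Reachable u w) := by
    clear hu
    obtain ⟨p⟩ := h
    induction p with
    | nil => exact Or.inr ⟨hw, SimpleGraph.Reachable.refl _⟩
    | @cons u u' w h p ih =>
      obtain ⟨hl, ho⟩ := h
      rcases ih hw with h1 | ⟨h1, h2⟩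
      · exact Or.inl h1
      · by_cases hu : u ∈ A
        · exact Or.inl ⟨u', ⟨h1, u, hu, hl⟩, h2⟩
        · have hadj : (openGraph (mask (touch A)ᶜ ω)).Adj u u' :=
            openGraph_mask_adj.2 ⟨hl, ho, fun h => by
              rcases (mk_mem_touch hl).1 h with h | h
              · exact hu h
              · exact h1 h⟩
          exact Or.inr ⟨hu, hadj.reachable.trans h2⟩
  rcases key with h | ⟨h, _⟩
  · exact h
  · exact absurd hu h

/-- The open cluster of `v` is not contained in `A`. For `v ∈ A` this means that `v` is joined to
`∂A`; for `v ∉ A` it always holds. -/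
def Exits (ω : Config d) (A : Set (Fin d → ℤ)) (v : Fin d → ℤ) : Prop :=
  ∃ w, w ∉ A ∧ (openGraph ω).Reachable v w

lemma Exits.mono {ω : Config d} {A B : Set (Fin d → ℤ)} {v : Fin d → ℤ} (h : Exits ω B v)
    (hAB : A ⊆ B) : Exits ω A v :=
  let ⟨w, hw, hr⟩ := h
  ⟨w, fun h => hw (hAB h), hr⟩

/-- Whether `v` leaves `A` is decided by the edges touching `A`. -/
lemma exits_mask_touch {ω : Config d} {A : Set (Fin d → ℤ)} {v : Fin d → ℤ} :
    Exits (mask (touch A) ω) A v ↔ Exits ω A v := by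
  constructor
  · rintro ⟨w, hw, hr⟩
    exact ⟨w, hw, hr.mono (openGraph_mask_le _ _)⟩
  · rintro ⟨w, hw, hr⟩
    by_cases hv : v ∈ A
    · obtain ⟨v', hv', hr'⟩ := exists_reachable_boundary_inside hv hw hr
      exact ⟨v', hv'.1, hr'⟩
    · exact ⟨v, hv, SimpleGraph.Reachable.refl _⟩

lemma dependsOn_exits (A : Set (Fin d → ℤ)) (v : Fin d → ℤ) :
    DependsOn (fun ω => Exits ω A v) (touch A) := by
  have := dependsOn_mask (touch A) (fun ω => Exits ω A v)
  simpa only [exits_mask_touch] using this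

lemma connected_singleton_boundary_iff {ω : Config d} {A : Set (Fin d → ℤ)} {v : Fin d → ℤ}
    (hv : v ∈ A) : Connected ω {v} (boundary A) ↔ Exits ω A v := by
  constructor
  · rintro ⟨_, rfl, w, hw, hr⟩
    exact ⟨w, hw.1, hr⟩
  · rintro ⟨w, hw, hr⟩
    obtain ⟨v', hv', hr'⟩ := exists_reachable_boundary_inside hv hw hr
    exact ⟨v, rfl, v', hv', hr'.mono (openGraph_mask_le _ _)⟩

/-- `∂A` is joined to `∂B` by open edges that touch `B` and do not touch `A`. -/
def Crosses (ω : Config d) (A B : Set (Fin d → ℤ)) : Prop :=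
  Connected (mask (touch B \ touch A) ω) (boundary A) (boundary B)

lemma dependsOn_crosses (A B : Set (Fin d → ℤ)) :
    DependsOn (fun ω => Crosses ω A B) (touch B \ touch A) :=
  dependsOn_mask _ fun ω => Connected ω (boundary A) (boundary B)

lemma Crosses.connected {ω : Config d} {A B : Set (Fin d → ℤ)} (h : Crosses ω A B) :
    Connected ω (boundary A) (boundary B) :=
  let ⟨v, hv, w, hw, hr⟩ := h
  ⟨v, hv, w, hw, hr.mono (openGraph_mask_le _ _)⟩

/-- A path from `A` out of `B ⊇ A` crosses the region in between after its last visit to `A` and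
before its first exit from `B` thereafter. -/
lemma Exits.crosses {ω : Config d} {A B : Set (Fin d → ℤ)} {x : Fin d → ℤ} (h : Exits ω B x)
    (hAB : A ⊆ B) (hx : x ∈ A) : Crosses ω A B := by
  obtain ⟨w, hw, hr⟩ := h
  obtain ⟨v, hv, hr'⟩ := exists_reachable_boundary_outside hx (fun h => hw (hAB h)) hr
  by_cases hvB : v ∈ B
  · obtain ⟨v', hv', hr''⟩ := exists_reachable_boundary_inside hvB hw hr'
    rw [mask_mask] at hr''
    exact ⟨v, hv, v', hv', hr''⟩
  · obtain ⟨_, u, hu, huv⟩ := hv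
    exact ⟨v, ⟨‹_›, u, hu, huv⟩, v, ⟨hvB, u, hAB hu, huv⟩, SimpleGraph.Reachable.refl _⟩

/-! ### Arm events -/

lemma mem_boundary_ball {z v : Fin d → ℤ} {n : ℕ} :
    v ∈ boundary (ball z n : Set (Fin d → ℤ)) ↔ v - z ∈ boundary (box d n) := by
  rw [← coe_ball_zero]
  simp only [boundary, Set.mem_ofPred_eq, Finset.mem_coe, mem_ball, sub_zero]
  refine and_congr Iff.rfl ⟨?_, ?_⟩
  · rintro ⟨u, hu, h⟩
    exact ⟨u - z, hu, by simpa [lattice] using h⟩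
  · rintro ⟨u, hu, h⟩
    refine ⟨u + z, by simpa using hu, ?_⟩
    have h' : ∑ i, |u i - (v - z) i| = 1 := h
    change ∑ i, |(u + z) i - v i| = 1
    rw [← h']
    refine Finset.sum_congr rfl fun i _ => ?_
    simp only [Pi.add_apply, Pi.sub_apply]
    congr 1
    ring

lemma measureReal_connected_boundary_ball (z : Fin d → ℤ) (l m : ℕ) :
    (critical d).real {ω | Connected ω (boundary (ball z l)) (boundary (ball z m))} =
      arm₂ d l m := by
  rw [arm₂, critical, ← measureReal_shift z _ fun ω => Connected ω (boundary (box d l)) _]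
  congr 1
  ext ω
  constructor
  · rintro ⟨v, hv, w, hw, hr⟩
    refine ⟨v - z, mem_boundary_ball.1 hv, w - z, mem_boundary_ball.1 hw, ?_⟩
    rw [openGraph_shift_reachable]
    simpa using hr
  · rintro ⟨v, hv, w, hw, hr⟩
    rw [openGraph_shift_reachable] at hr
    exact ⟨v + z, mem_boundary_ball.2 (by simpa using hv), w + z,
      mem_boundary_ball.2 (by simpa using hw), hr⟩

/-- The restriction to edges between the two boxes, which makes `Crosses` independent of the inner
box, does not increase the probability. -/
lemma measureReal_crosses_le (z : Fin d → ℤ) (l m : ℕ) :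
    (critical d).real {ω | Crosses ω (ball z l : Set (Fin d → ℤ)) (ball z m)} ≤ arm₂ d l m := by
  rw [← measureReal_connected_boundary_ball z]
  exact measureReal_mono fun ω h => Crosses.connected h

lemma arm₂_nonneg (l m : ℕ) : 0 ≤ arm₂ d l m := measureReal_nonneg

lemma box_mono {l m : ℕ} (h : l ≤ m) : box d l ⊆ box d m := fun v hv i =>
  (hv i).trans (by exact_mod_cast h)

lemma arm₂_anti_right {k l m : ℕ} (hkl : k ≤ l) (hlm : l ≤ m) : arm₂ d k m ≤ arm₂ d k l := by
  refine measureReal_mono ?_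
  rintro ω ⟨v, ⟨hv, u, hu, huv⟩, w, hw, hr⟩
  by_cases hvl : v ∈ box d l
  · obtain ⟨v', hv', hr'⟩ := exists_reachable_boundary_inside hvl
      (fun h => hw.1 (box_mono hlm h)) hr
    exact ⟨v, ⟨hv, u, hu, huv⟩, v', hv', hr'.mono (openGraph_mask_le _ _)⟩
  · exact ⟨v, ⟨hv, u, hu, huv⟩, v, ⟨hvl, u, box_mono hkl hu, huv⟩, SimpleGraph.Reachable.refl _⟩

lemma arm₂_mono_left {k l m : ℕ} (hkl : k ≤ l) (hlm : l ≤ m) : arm₂ d k m ≤ arm₂ d l m := by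
  refine measureReal_mono ?_
  rintro ω ⟨v, ⟨hv, u, hu, huv⟩, w, hw, hr⟩
  by_cases hvl : v ∈ box d l
  · obtain ⟨v', hv', hr'⟩ := exists_reachable_boundary_outside hvl
      (fun h => hw.1 (box_mono hlm h)) hr
    exact ⟨v', hv', w, hw, hr'.mono (openGraph_mask_le _ _)⟩
  · exact ⟨v, ⟨hvl, u, box_mono hkl hu, huv⟩, w, hw, hr⟩

/-! ### Consequences of the hypotheses on the one-arm probabilities -/

/-- The form in which the two hypotheses are used. Since
the exponent `α` may be increased below `d`, it is taken in `[d - 1, d)`; this makes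
`t ↦ t ^ (d - α)` concave. -/
structure ArmBounds (d : ℕ) (C α : ℝ) : Prop where
  one_le : 1 ≤ C
  lt_dim : α < d
  nonneg : 0 ≤ α
  dim_le : (d : ℝ) ≤ α + 1
  pos : ∀ t : ℕ, 1 ≤ t → 0 < arm₂ d 1 t
  le_mul : ∀ m n : ℕ, 1 ≤ m → m ≤ n → arm₂ d 1 m ≤ C * ((n : ℝ) / m) ^ α * arm₂ d 1 n
  annulus : ∀ l m : ℕ, 1 ≤ l → l ≤ m → arm₂ d l m * arm₂ d 1 l ≤ C * arm₂ d 1 m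

lemma arm_natCast (n : ℕ) : arm d (n : ℝ) = arm₂ d 1 n := by
  rw [arm, Nat.floor_natCast]

lemma exists_armBounds (hd : 2 ≤ d) {C₁ C₂ α : ℝ} (hC₂ : 0 < C₂) (hα : α < d)
    (h1 : QuasiMultiplicative d C₁) (h2 : OneArmLowerBound d C₂ α) :
    ∃ C α', ArmBounds d C α' := by
  have hd' : (2 : ℝ) ≤ d := by exact_mod_cast hd
  have hpos : ∀ t : ℕ, 1 ≤ t → 0 < arm₂ d 1 t := by
    intro t ht
    have h := h2 t t ht le_rfl
    have ht' : (0 : ℝ) < t := by exact_mod_cast ht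
    rw [arm_natCast, div_self ht'.ne', Real.one_rpow, mul_one] at h
    refine lt_of_le_of_ne (arm₂_nonneg 1 t) fun h0 => ?_
    rw [← h0, div_zero] at h
    exact absurd h (not_le.2 hC₂)
  refine ⟨max 1 (max C₁ C₂⁻¹), max α (d - 1), le_max_left _ _, max_lt hα (by linarith),
    le_trans (by linarith) (le_max_right _ _), ?_, hpos, ?_, ?_⟩
  · have := le_max_right α ((d : ℝ) - 1)
    linarith
  · intro m n hm hmn
    have h := h2 m n hm hmn
    have hm' : (0 : ℝ) < m := by exact_mod_cast hm
    have hr : (1 : ℝ) ≤ (n : ℝ) / m := by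
      rw [one_le_div hm']; exact_mod_cast hmn
    rw [arm_natCast, arm_natCast, le_div_iff₀ (hpos m hm), Real.rpow_neg (by linarith)] at h
    have hx : 0 < ((n : ℝ) / m) ^ α := Real.rpow_pos_of_pos (by linarith) _
    have h3 : arm₂ d 1 m ≤ C₂⁻¹ * ((n : ℝ) / m) ^ α * arm₂ d 1 n := by
      calc arm₂ d 1 m = C₂⁻¹ * ((n : ℝ) / m) ^ α * (C₂ * (((n : ℝ) / m) ^ α)⁻¹ * arm₂ d 1 m) := by
            field_simp
        _ ≤ _ := by gcongr
    refine h3.trans ?_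
    have := arm₂_nonneg (d := d) 1 n
    gcongr ?_ * _ ^ ?_ * _
    · exact (le_max_right _ _).trans (le_max_right _ _)
    · exact le_max_left _ _
  · intro l m hl hlm
    have h := h1 1 l m hl hlm
    rw [mul_comm] at h
    refine h.trans ?_
    have := arm₂_nonneg (d := d) 1 m
    gcongr
    exact (le_max_left _ _).trans (le_max_right _ _)

namespace ArmBounds

variable {C α : ℝ} (H : ArmBounds d C α)
include H

/-- Changing the scale by a bounded factor changes the one-arm probability by a bounded factor. -/
lemma le_of_le_mul {K : ℕ} (hK : 1 ≤ K) {m n : ℕ} (hm : 1 ≤ m) (hn : 1 ≤ n) (h : n ≤ K * m) :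
    arm₂ d 1 m ≤ C * (K : ℝ) ^ α * arm₂ d 1 n := by
  have hC := H.one_le
  have hK' : (1 : ℝ) ≤ K := by exact_mod_cast hK
  have hn0 := arm₂_nonneg (d := d) 1 n
  rcases le_total n m with hnm | hmn
  · have h1 : 1 ≤ (K : ℝ) ^ α := Real.one_le_rpow hK' H.nonneg
    calc arm₂ d 1 m ≤ arm₂ d 1 n := arm₂_anti_right hn hnm
      _ ≤ C * (K : ℝ) ^ α * arm₂ d 1 n :=
        le_mul_of_one_le_left hn0 (one_le_mul_of_one_le_of_one_le hC h1)
  · have hm' : (0 : ℝ) < m := by exact_mod_cast hm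
    refine (H.le_mul m n hm hmn).trans ?_
    have h1 : (n : ℝ) / m ≤ K := by
      rw [div_le_iff₀ hm']; exact_mod_cast h
    have := H.nonneg
    gcongr

/-- The typical number `t ^ d π(t)` of vertices with a long arm grows at least like
`t ^ (d - α)`. -/
lemma volume_le_rpow_mul {t T : ℕ} (ht : 1 ≤ t) (htT : t ≤ T) :
    (t : ℝ) ^ d * arm₂ d 1 t ≤
      C * ((t : ℝ) / T) ^ ((d : ℝ) - α) * ((T : ℝ) ^ d * arm₂ d 1 T) := by
  have ht' : (0 : ℝ) < t := by exact_mod_cast ht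
  have hT0 : (0 : ℝ) < T := by exact_mod_cast ht.trans htT
  have e : (t : ℝ) ^ d * ((T : ℝ) / t) ^ α = ((t : ℝ) / T) ^ ((d : ℝ) - α) * (T : ℝ) ^ d := by
    rw [Real.rpow_sub (by positivity), Real.rpow_natCast, Real.div_rpow hT0.le ht'.le,
      Real.div_rpow ht'.le hT0.le, div_pow]
    have h1 := (Real.rpow_pos_of_pos ht' α).ne'
    have h2 := (Real.rpow_pos_of_pos hT0 α).ne'
    field_simp
  calc _ ≤ (t : ℝ) ^ d * (C * ((T : ℝ) / t) ^ α * arm₂ d 1 T) := by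
        gcongr; exact H.le_mul t T ht htT
    _ = C * ((t : ℝ) ^ d * ((T : ℝ) / t) ^ α) * arm₂ d 1 T := by ring
    _ = _ := by rw [e]; ring

lemma volume_le {t T : ℕ} (ht : 1 ≤ t) (htT : t ≤ T) :
    (t : ℝ) ^ d * arm₂ d 1 t ≤ C * ((T : ℝ) ^ d * arm₂ d 1 T) := by
  have hT' : (t : ℝ) ≤ T := by exact_mod_cast htT
  have hC := H.one_le
  have ha := arm₂_nonneg (d := d) 1 T
  have h1 : ((t : ℝ) / T) ^ ((d : ℝ) - α) ≤ 1 :=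
    Real.rpow_le_one (by positivity) (div_le_one_of_le₀ hT' (by positivity))
      (sub_nonneg.2 H.lt_dim.le)
  refine (H.volume_le_rpow_mul ht htT).trans ?_
  gcongr
  exact mul_le_of_le_one_right (by linarith) h1

lemma arm₂_one_one : arm₂ d 1 1 = 1 := by
  have hb : (boundary (box d 1)).Nonempty := by
    by_contra hne
    have := H.pos 1 le_rfl
    rw [Set.not_nonempty_iff_eq_empty] at hne
    simp [arm₂, hne, Connected] at this
  obtain ⟨v, hv⟩ := hb
  have : {ω : Config d | Connected ω (boundary (box d 1)) (boundary (box d 1))} = Set.univ :=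
    Set.eq_univ_of_forall fun ω => ⟨v, hv, v, hv, SimpleGraph.Reachable.refl _⟩
  rw [arm₂, this, probReal_univ]

/-- The expected order `n ^ d π(n)` of `|V_n|` is bounded below. -/
lemma le_volume {n : ℕ} (hn : 1 ≤ n) : C⁻¹ ≤ (n : ℝ) ^ d * arm₂ d 1 n := by
  have h := H.volume_le le_rfl hn
  rw [H.arm₂_one_one] at h
  have hC : 0 < C := by linarith [H.one_le]
  rw [inv_le_iff_one_le_mul₀' hC]
  simpa using h

/-- `∑ t ^ (β - 1) ≤ T ^ β / β`, in a form free of division. -/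
lemma sum_rpow_le (T : ℕ) :
    (d - α) * ∑ t ∈ Finset.Icc 1 T, (t : ℝ) ^ ((d : ℝ) - α - 1) ≤ (T : ℝ) ^ ((d : ℝ) - α) := by
  have hβ : 0 < (d : ℝ) - α := by linarith [H.lt_dim]
  induction T with
  | zero => simp [Real.zero_rpow hβ.ne']
  | succ T ih =>
    rw [Finset.sum_Icc_succ_top (by omega), mul_add]
    set β := (d : ℝ) - α
    have hβ1 : β ≤ 1 := by have := H.dim_le; simp only [β]; linarith
    have hT : (0 : ℝ) < ((T + 1 : ℕ) : ℝ) := by positivity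
    -- Bernoulli's inequality for the concave power `β`
    have hB := rpow_one_add_le_one_add_mul_self (s := -(1 / ((T + 1 : ℕ) : ℝ))) (p := β)
      (by
        rw [neg_le_neg_iff, div_le_one hT]
        push_cast
        linarith [(Nat.cast_nonneg T : (0 : ℝ) ≤ T)]) hβ.le hβ1
    have e1 : (1 + -(1 / ((T + 1 : ℕ) : ℝ))) = (T : ℝ) / ((T + 1 : ℕ) : ℝ) := by
      field_simp; push_cast; ring
    rw [e1, Real.div_rpow (Nat.cast_nonneg T) hT.le, div_le_iff₀ (Real.rpow_pos_of_pos hT _)] at hB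
    have e3 : (1 + β * -(1 / ((T + 1 : ℕ) : ℝ))) * ((T + 1 : ℕ) : ℝ) ^ β =
        ((T + 1 : ℕ) : ℝ) ^ β - β * ((T + 1 : ℕ) : ℝ) ^ (β - 1) := by
      rw [Real.rpow_sub_one hT.ne']; field_simp; ring
    rw [e3] at hB
    linarith

/-- The sums over scales that occur in the moment bounds are dominated by the largest scale. -/
lemma sum_scales_le (j : ℕ) : ∃ K : ℝ, 0 ≤ K ∧ ∀ T : ℕ, 1 ≤ T →
    ∑ t ∈ Finset.Icc 1 T, (t : ℝ) ^ (d - 1) * arm₂ d 1 t * ((t : ℝ) ^ d * arm₂ d 1 t) ^ j ≤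
      K * ((T : ℝ) ^ d * arm₂ d 1 T) ^ (j + 1) := by
  have hβ : 0 < (d : ℝ) - α := by linarith [H.lt_dim]
  have hC : 0 < C := by linarith [H.one_le]
  have hd : 1 ≤ d := by
    have := H.nonneg
    have h := H.lt_dim
    exact_mod_cast (Nat.one_le_iff_ne_zero.2 (by rintro rfl; simp at h; linarith))
  refine ⟨C ^ (j + 1) * ((d : ℝ) - α)⁻¹, by positivity, fun T hT => ?_⟩
  have hT0 : (0 : ℝ) < T := by exact_mod_cast hT
  have haT := arm₂_nonneg (d := d) 1 T
  have step : ∀ t ∈ Finset.Icc 1 T,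
      (t : ℝ) ^ (d - 1) * arm₂ d 1 t * ((t : ℝ) ^ d * arm₂ d 1 t) ^ j ≤
      (C ^ (j + 1) * ((T : ℝ) ^ α * arm₂ d 1 T) * ((T : ℝ) ^ d * arm₂ d 1 T) ^ j) *
        (t : ℝ) ^ ((d : ℝ) - α - 1) := by
    intro t ht
    obtain ⟨ht1, htT⟩ := Finset.mem_Icc.1 ht
    have ht0 : (0 : ℝ) < t := by exact_mod_cast ht1
    have hat := arm₂_nonneg (d := d) 1 t
    have h1 := H.volume_le ht1 htT
    have h2 : (t : ℝ) ^ (d - 1) * arm₂ d 1 t ≤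
        C * ((T : ℝ) ^ α * arm₂ d 1 T) * (t : ℝ) ^ ((d : ℝ) - α - 1) := by
      have e : (t : ℝ) ^ ((d : ℝ) - α - 1) = (t : ℝ) ^ (d - 1) / (t : ℝ) ^ α := by
        rw [← Real.rpow_natCast, ← Real.rpow_sub ht0, Nat.cast_sub hd]
        congr 1
        push_cast
        ring
      rw [e]
      calc _ ≤ (t : ℝ) ^ (d - 1) * (C * ((T : ℝ) / t) ^ α * arm₂ d 1 T) := by
            gcongr; exact H.le_mul t T ht1 htT
        _ = _ := by rw [Real.div_rpow hT0.le ht0.le]; ring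
    calc _ ≤ (C * ((T : ℝ) ^ α * arm₂ d 1 T) * (t : ℝ) ^ ((d : ℝ) - α - 1)) *
          (C * ((T : ℝ) ^ d * arm₂ d 1 T)) ^ j := by gcongr
      _ = _ := by rw [mul_pow]; ring
  refine (Finset.sum_le_sum step).trans ?_
  rw [← Finset.mul_sum]
  have h3 : ∑ t ∈ Finset.Icc 1 T, (t : ℝ) ^ ((d : ℝ) - α - 1) ≤
      ((d : ℝ) - α)⁻¹ * (T : ℝ) ^ ((d : ℝ) - α) := by
    rw [le_inv_mul_iff₀ hβ]
    exact H.sum_rpow_le T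
  calc _ ≤ (C ^ (j + 1) * ((T : ℝ) ^ α * arm₂ d 1 T) * ((T : ℝ) ^ d * arm₂ d 1 T) ^ j) *
        (((d : ℝ) - α)⁻¹ * (T : ℝ) ^ ((d : ℝ) - α)) := by gcongr
    _ = _ := by
      have e : (T : ℝ) ^ α * (T : ℝ) ^ ((d : ℝ) - α) = (T : ℝ) ^ d := by
        rw [← Real.rpow_add hT0, ← Real.rpow_natCast]
        congr 1
        ring
      rw [← e]
      ring

end ArmBounds

/-! ### Splitting a finite set at its largest gap -/

/-- Every partition of `S` into two nonempty parts has a pair of points, one in each part, at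
distance at most `t`; equivalently, the pairs at distance at most `t` make `S` a connected
graph. -/
def Linked (t : ℕ) (S : Finset (Fin d → ℤ)) : Prop :=
  ∀ A ⊂ S, A.Nonempty → ∃ a ∈ A, ∃ b ∈ S \ A, supNorm (b - a) ≤ t

/-- The diameter of a connected set: the ball of radius `j t` around `x` contains at least `j + 1`
points of `S`, unless it contains all of `S`. -/
lemma Linked.supNorm_le {t : ℕ} {S : Finset (Fin d → ℤ)} (hS : Linked t S) {x y : Fin d → ℤ}
    (hx : x ∈ S) (hy : y ∈ S) : supNorm (y - x) ≤ (S.card - 1) * t := by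
  have key : ∀ j, S.filter (fun u => supNorm (u - x) ≤ j * t) = S ∨
      j + 1 ≤ (S.filter (fun u => supNorm (u - x) ≤ j * t)).card := by
    intro j
    induction j with
    | zero =>
      right
      rw [Nat.succ_le_iff, Finset.card_pos]
      exact ⟨x, by simp [hx, supNorm_zero]⟩
    | succ j ih =>
      have hsub : S.filter (fun u => supNorm (u - x) ≤ j * t) ⊆
          S.filter (fun u => supNorm (u - x) ≤ (j + 1) * t) := by
        intro u hu
        rw [Finset.mem_filter] at hu ⊢
        exact ⟨hu.1, hu.2.trans (Nat.mul_le_mul_right t (by omega))⟩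
      by_cases h : S.filter (fun u => supNorm (u - x) ≤ j * t) = S
      · left
        refine Finset.Subset.antisymm (Finset.filter_subset _ _) ?_
        rwa [h] at hsub
      · right
        have h1 := ih.resolve_left h
        obtain ⟨a, ha, b, hb, hab⟩ := hS _ ((Finset.filter_subset _ _).ssubset_of_ne h)
          ⟨x, by simp [hx, supNorm_zero]⟩
        rw [Finset.mem_sdiff] at hb
        rw [Finset.mem_filter] at ha
        refine lt_of_le_of_lt h1 (Finset.card_lt_card (hsub.ssubset_of_ne fun he => hb.2 ?_))
        rw [he, Finset.mem_filter]
        refine ⟨hb.1, (supNorm_sub_le b a x).trans ?_⟩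
        have := ha.2
        rw [add_mul, one_mul]
        omega
  have hc : 0 < S.card := Finset.card_pos.2 ⟨x, hx⟩
  have h : S.filter (fun u => supNorm (u - x) ≤ (S.card - 1) * t) = S := by
    rcases key (S.card - 1) with h | h
    · exact h
    · exact Finset.eq_of_subset_of_card_le (Finset.filter_subset _ _) (by omega)
  rw [← h] at hy
  exact (Finset.mem_filter.1 hy).2

/-- At the smallest scale `t` at which it is connected, a set splits into two parts at distance
exactly `t`, both connected at scale `t`. -/
lemma Linked.exists_split {T : ℕ} {S : Finset (Fin d → ℤ)} (hS : Linked T S) {x : Fin d → ℤ}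
    (hx : x ∈ S) (hc : 2 ≤ S.card) :
    ∃ t A B, 1 ≤ t ∧ t ≤ T ∧ x ∈ A ∧ A ∪ B = S ∧ Disjoint A B ∧ Linked t S ∧ Linked t A ∧
      Linked t B ∧ (∀ a ∈ A, ∀ b ∈ B, t ≤ supNorm (b - a)) ∧
      ∃ a ∈ A, ∃ b ∈ B, supNorm (b - a) = t := by
  classical
  -- `t` is the least scale at which `S` is connected
  have hex : ∃ t, Linked t S := ⟨T, hS⟩
  obtain ⟨t, ht, htmin⟩ : ∃ t, Linked t S ∧ ∀ s, Linked s S → t ≤ s :=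
    ⟨Nat.find hex, Nat.find_spec hex, fun s hs => Nat.find_min' hex hs⟩
  have ht1 : 1 ≤ t := by
    have hne : ({x} : Finset (Fin d → ℤ)) ≠ S := by
      rintro rfl
      simp at hc
    obtain ⟨a, ha, b, hb, hab⟩ := ht {x}
      ((Finset.singleton_subset_iff.2 hx).ssubset_of_ne hne) ⟨x, by simp⟩
    rw [Finset.mem_sdiff] at hb
    by_contra h0
    have h1 : supNorm (b - a) = 0 := by omega
    rw [supNorm_eq_zero_iff, sub_eq_zero] at h1
    exact hb.2 (h1 ▸ ha)
  let P : Finset (Fin d → ℤ) → Prop := fun A =>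
    x ∈ A ∧ A ⊂ S ∧ ∀ a ∈ A, ∀ b ∈ S \ A, t ≤ supNorm (b - a)
  have hP : ∃ A, P A := by
    have hn : ¬ Linked (t - 1) S := fun h => by
      have := htmin _ h
      omega
    unfold Linked at hn
    push Not at hn
    obtain ⟨A, hA, hAne, h⟩ := hn
    by_cases hxA : x ∈ A
    · exact ⟨A, hxA, hA, fun a ha b hb => by have := h a ha b hb; omega⟩
    · refine ⟨S \ A, Finset.mem_sdiff.2 ⟨hx, hxA⟩, Finset.sdiff_ssubset hA.1 hAne, ?_⟩
      intro a ha b hb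
      rw [Finset.sdiff_sdiff_eq_self hA.1] at hb
      have := h b hb a ha
      rw [supNorm_sub_comm]
      omega
  -- a cut of minimal size around `x` has a connected side
  have hPL : ∃ A, P A ∧ Linked t A := by
    obtain ⟨A, hA, hmin⟩ : ∃ A, P A ∧ ∀ A', P A' → A.card ≤ A'.card := by
      have hex' : ∃ n, ∃ A, P A ∧ A.card = n := let ⟨A, hA⟩ := hP; ⟨_, A, hA, rfl⟩
      obtain ⟨A, hA, hAc⟩ := Nat.find_spec hex'
      exact ⟨A, hA, fun A' hA' => hAc ▸ Nat.find_min' hex' ⟨A', hA', rfl⟩⟩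
    refine ⟨A, hA, fun A₁ hA₁ hne => ?_⟩
    by_contra hcon
    push Not at hcon
    have hPsub : ∀ A', A' ⊂ A → x ∈ A' → (∀ a ∈ A', ∀ b ∈ A \ A', t < supNorm (b - a)) →
        False := by
      intro A' hA' hxA' hgap
      have hcard := hmin A' ⟨hxA', hA'.trans hA.2.1, fun a ha b hb => by
        rw [Finset.mem_sdiff] at hb
        by_cases hbA : b ∈ A
        · exact (hgap a ha b (Finset.mem_sdiff.2 ⟨hbA, hb.2⟩)).le
        · exact hA.2.2 a (hA'.1 ha) b (Finset.mem_sdiff.2 ⟨hb.1, hbA⟩)⟩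
      exact absurd (Finset.card_lt_card hA') (not_lt.2 hcard)
    by_cases hxA₁ : x ∈ A₁
    · exact hPsub A₁ hA₁ hxA₁ hcon
    · refine hPsub (A \ A₁) (Finset.sdiff_ssubset hA₁.1 hne)
        (Finset.mem_sdiff.2 ⟨hA.1, hxA₁⟩) fun a ha b hb => ?_
      rw [Finset.sdiff_sdiff_eq_self hA₁.1] at hb
      rw [supNorm_sub_comm]
      exact hcon b hb a ha
  -- among such cuts, one of maximal size also has its other side connected
  obtain ⟨A, ⟨hA, hAL⟩, hmax⟩ : ∃ A, (P A ∧ Linked t A) ∧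
      ∀ A', P A' ∧ Linked t A' → A'.card ≤ A.card := by
    obtain ⟨A, hA, h⟩ := Finset.exists_max_image (S.powerset.filter fun A => P A ∧ Linked t A)
      Finset.card (let ⟨A, hA⟩ := hPL
        ⟨A, Finset.mem_filter.2 ⟨Finset.mem_powerset.2 hA.1.2.1.1, hA⟩⟩)
    refine ⟨A, (Finset.mem_filter.1 hA).2, fun A' hA' => h A' ?_⟩
    exact Finset.mem_filter.2 ⟨Finset.mem_powerset.2 hA'.1.2.1.1, hA'⟩
  obtain ⟨a, ha, b, hb, hab⟩ := ht A hA.2.1 ⟨x, hA.1⟩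
  refine ⟨t, A, S \ A, ht1, htmin T hS, hA.1, Finset.union_sdiff_of_subset hA.2.1.1,
    Finset.disjoint_sdiff, ht, hAL, ?_, hA.2.2, a, ha, b, hb, le_antisymm hab (hA.2.2 a ha b hb)⟩
  intro B₁ hB₁ hne
  by_contra hcon
  push Not at hcon
  have hB₁S : ∀ b ∈ B₁, b ∈ S ∧ b ∉ A := fun b hb => Finset.mem_sdiff.1 (hB₁.1 hb)
  obtain ⟨b₂, hb₂, hb₂'⟩ := Finset.exists_of_ssubset hB₁
  have hPA' : P (A ∪ B₁) := by
    refine ⟨Finset.mem_union_left _ hA.1, ?_, ?_⟩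
    · refine Finset.ssubset_iff_subset_ne.2 ⟨Finset.union_subset hA.2.1.1
        (hB₁.1.trans Finset.sdiff_subset), fun he => ?_⟩
      have h3 := Finset.mem_sdiff.1 hb₂
      have h4 := h3.1
      rw [← he, Finset.mem_union] at h4
      exact h4.elim h3.2 hb₂'
    · intro a ha b hb
      rw [Finset.mem_sdiff, Finset.mem_union, not_or] at hb
      have hb' : b ∈ S \ A := Finset.mem_sdiff.2 ⟨hb.1, hb.2.1⟩
      rcases Finset.mem_union.1 ha with ha | ha
      · exact hA.2.2 a ha b hb'
      · exact (hcon a ha b (Finset.mem_sdiff.2 ⟨hb', hb.2.2⟩)).le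
  -- a part of `B₁` is joined to the rest of `S`, and not through `S \ (A ∪ B₁)`
  have hpart : ∀ D ⊆ B₁, D.Nonempty → ∃ a ∈ D, ∃ b ∈ (A ∪ B₁) \ D, supNorm (b - a) ≤ t := by
    intro D hD hDne
    have hDS : D ⊂ S := Finset.ssubset_iff_subset_ne.2
      ⟨fun u hu => (hB₁S u (hD hu)).1, fun he => by
        have := hD (he ▸ hx)
        exact (hB₁S x this).2 hA.1⟩
    obtain ⟨a, ha, b, hb, hab⟩ := ht D hDS hDne
    rw [Finset.mem_sdiff] at hb
    refine ⟨a, ha, b, Finset.mem_sdiff.2 ⟨?_, hb.2⟩, hab⟩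
    by_contra hbn
    rw [Finset.mem_union, not_or] at hbn
    have := hcon a (hD ha) b (Finset.mem_sdiff.2 ⟨Finset.mem_sdiff.2 ⟨hb.1, hbn.1⟩, hbn.2⟩)
    omega
  have hLA' : Linked t (A ∪ B₁) := by
    intro D hD hDne
    by_cases h1 : (A ∩ D).Nonempty
    · by_cases h2 : A ⊆ D
      · obtain ⟨a, ha, b, hb, hab⟩ := hpart ((A ∪ B₁) \ D) (fun u hu => by
          rw [Finset.mem_sdiff, Finset.mem_union] at hu
          exact hu.1.resolve_left fun h => hu.2 (h2 h)) (Finset.sdiff_nonempty.2 hD.2)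
        rw [Finset.sdiff_sdiff_eq_self hD.1] at hb
        exact ⟨b, hb, a, ha, by rwa [supNorm_sub_comm]⟩
      · obtain ⟨a, ha, b, hb, hab⟩ := hAL (A ∩ D)
          (Finset.ssubset_iff_subset_ne.2 ⟨Finset.inter_subset_left, fun he =>
            h2 (Finset.inter_eq_left.1 he)⟩) h1
        rw [Finset.mem_sdiff, Finset.mem_inter, not_and] at hb
        exact ⟨a, (Finset.mem_inter.1 ha).2, b,
          Finset.mem_sdiff.2 ⟨Finset.mem_union_left _ hb.1, hb.2 hb.1⟩, hab⟩
    · refine hpart D (fun u hu => ?_) hDne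
      refine (Finset.mem_union.1 (hD.1 hu)).resolve_left fun h => h1 ⟨u, ?_⟩
      exact Finset.mem_inter.2 ⟨h, hu⟩
  have hcard := hmax _ ⟨hPA', hLA'⟩
  rw [Finset.card_union_of_disjoint (Finset.disjoint_left.2 fun u hu hu' => (hB₁S u hu').2 hu)]
    at hcard
  have := Finset.card_pos.2 hne
  omega

/-! ### Several vertices with long arms -/

/-- The points at distance less than `ρ` from `x`; empty for `ρ = 0`. -/
def openBall (x : Fin d → ℤ) (ρ : ℕ) : Set (Fin d → ℤ) := {u | supNorm (u - x) < ρ}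

lemma openBall_succ (x : Fin d → ℤ) (n : ℕ) :
    openBall x (n + 1) = (ball x n : Set (Fin d → ℤ)) := by
  ext u
  rw [Finset.mem_coe, mem_ball, ← Nat.lt_succ_iff]
  rfl

lemma finite_openBall (x : Fin d → ℤ) (ρ : ℕ) : (openBall x ρ).Finite :=
  (ball x ρ).finite_toSet.subset fun u hu => by
    rw [Finset.mem_coe, mem_ball]
    exact le_of_lt hu

lemma openBall_mono (x : Fin d → ℤ) {ρ τ : ℕ} (h : ρ ≤ τ) : openBall x ρ ⊆ openBall x τ :=
  fun _ hu => lt_of_lt_of_le hu h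

/-- Every vertex of `S` is joined to distance `ρ` from itself. -/
def AllReach (ω : Config d) (S : Finset (Fin d → ℤ)) (ρ : ℕ) : Prop :=
  ∀ x ∈ S, Exits ω (openBall x ρ) x

/-- The edges on which `AllReach ω S ρ` depends. -/
def reachEdges (S : Finset (Fin d → ℤ)) (ρ : ℕ) : Set (lattice d).edgeSet :=
  touch (⋃ x ∈ S, openBall x ρ)

lemma finite_reachEdges (S : Finset (Fin d → ℤ)) (ρ : ℕ) : (reachEdges S ρ).Finite :=
  finite_touch (S.finite_toSet.biUnion fun x _ => finite_openBall x ρ)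

lemma touch_mono {A B : Set (Fin d → ℤ)} (h : A ⊆ B) : touch A ⊆ touch B :=
  fun _ ⟨v, hv, hve⟩ => ⟨v, h hv, hve⟩

lemma dependsOn_allReach (S : Finset (Fin d → ℤ)) (ρ : ℕ) :
    DependsOn (fun ω => AllReach ω S ρ) (reachEdges S ρ) := by
  intro ω ω' h
  refine propext (forall_congr' fun x => forall_congr' fun hx => ?_)
  refine iff_of_eq (dependsOn_exits (openBall x ρ) x fun e he => h e (touch_mono ?_ he))
  exact Set.subset_biUnion_of_mem (u := fun x => openBall x ρ) hx

/-- Independence of events determined by disjoint finite sets of edges. -/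
lemma measureReal_and_of_finite {P Q : Config d → Prop} {F G : Set (lattice d).edgeSet}
    (hP : DependsOn P F) (hQ : DependsOn Q G) (hF : F.Finite) (hG : G.Finite)
    (hFG : Disjoint F G) :
    (critical d).real {ω | P ω ∧ Q ω} =
      (critical d).real {ω | P ω} * (critical d).real {ω | Q ω} := by
  lift F to Finset (lattice d).edgeSet using hF
  lift G to Finset (lattice d).edgeSet using hG
  exact measureReal_and_of_dependsOn hP hQ (Finset.disjoint_coe.1 hFG) _

namespace ArmBounds

variable {C α : ℝ} (H : ArmBounds d C α)
include H

/-- The arm from a vertex to distance `T / 2` contains an arm from `∂Λ_0`, hence from `∂Λ_1`, to a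
scale comparable with `T`. -/
lemma measureReal_exits_le : ∃ K : ℝ, 0 ≤ K ∧ ∀ (x : Fin d → ℤ) (T : ℕ), 1 ≤ T →
    (critical d).real {ω | Exits ω (openBall x (T / 2)) x} ≤ K * arm₂ d 1 T := by
  have hC : 0 < C := by linarith [H.one_le]
  refine ⟨C * ((5 : ℕ) : ℝ) ^ α, by positivity, fun x T hT => ?_⟩
  by_cases h4 : T < 4
  · have h := H.le_of_le_mul (K := 5) (by norm_num) (le_refl 1) hT (by omega)
    rw [H.arm₂_one_one] at h
    exact measureReal_le_one.trans h
  · obtain ⟨n, hn⟩ : ∃ n, T / 2 = n + 1 + 1 := ⟨T / 2 - 2, by omega⟩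
    have h := H.le_of_le_mul (K := 5) (m := n + 1) (n := T) (by norm_num) (by omega) hT (by omega)
    refine le_trans ?_ h
    refine le_trans ?_ (arm₂_mono_left (k := 0) (l := 1) (m := n + 1) (by omega) (by omega))
    refine le_trans ?_ (measureReal_crosses_le x 0 (n + 1))
    refine measureReal_mono fun ω hω => ?_
    rw [Set.mem_ofPred_eq, hn, openBall_succ] at hω
    refine hω.crosses (fun u hu => ?_) (mem_ball_self x 0)
    rw [Finset.mem_coe, mem_ball] at hu ⊢
    omega

/-- If `S` splits into two parts at distance `t`, then the arms of length `t / 2` from the two parts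
and one arm from scale `t` to scale `T` are independent; quasi-multiplicativity bounds the
probability of the last one by `π(T) / π(t)`. -/
lemma measureReal_allReach_union_le (k : ℕ) : ∃ K : ℝ, 0 ≤ K ∧
    ∀ (t T : ℕ) (x : Fin d → ℤ) (A B : Finset (Fin d → ℤ)), 1 ≤ t → t ≤ T → x ∈ A →
      (∀ y ∈ A ∪ B, supNorm (y - x) ≤ k * t) → (∀ a ∈ A, ∀ b ∈ B, t ≤ supNorm (b - a)) →
      (critical d).real {ω | AllReach ω (A ∪ B) (T / 2)} * arm₂ d 1 t ≤
        K * (critical d).real {ω | AllReach ω A (t / 2)} *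
          (critical d).real {ω | AllReach ω B (t / 2)} * arm₂ d 1 T := by
  have hC : 1 ≤ C := H.one_le
  have hC0 : 0 < C := by linarith
  refine ⟨C * (C * ((2 * k + 7 : ℕ) : ℝ) ^ α) +
    C * ((k + 1 : ℕ) : ℝ) ^ α * (C * (C * ((5 : ℕ) : ℝ) ^ α)), by positivity, ?_⟩
  intro t T x A B ht htT hx hdiam hgap
  have hT : 1 ≤ T := ht.trans htT
  have hdisj : Disjoint (reachEdges A (t / 2)) (reachEdges B (t / 2)) := by
    refine disjoint_touch fun u hu v hv => ?_
    simp only [Set.mem_iUnion] at hu hv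
    obtain ⟨a, ha, hua⟩ := hu
    obtain ⟨b, hb, hvb⟩ := hv
    have h1 := hgap a ha b hb
    have h2 : supNorm (u - a) < t / 2 := hua
    have h3 : supNorm (v - b) < t / 2 := hvb
    have h4 := supNorm_sub_le b v a
    have h5 := supNorm_sub_le v u a
    rw [supNorm_sub_comm b v] at h4
    rw [supNorm_sub_comm v u] at h5
    omega
  have hAB : (critical d).real {ω | AllReach ω A (t / 2) ∧ AllReach ω B (t / 2)} =
      (critical d).real {ω | AllReach ω A (t / 2)} *
        (critical d).real {ω | AllReach ω B (t / 2)} :=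
    measureReal_and_of_finite (dependsOn_allReach _ _) (dependsOn_allReach _ _)
      (finite_reachEdges _ _) (finite_reachEdges _ _) hdisj
  have hsub : ∀ ω, AllReach ω (A ∪ B) (T / 2) → AllReach ω A (t / 2) ∧ AllReach ω B (t / 2) := by
    intro ω h
    have hm : ∀ y : Fin d → ℤ, openBall y (t / 2) ⊆ openBall y (T / 2) := fun y =>
      openBall_mono y (Nat.div_le_div_right htT)
    exact ⟨fun y hy => (h y (Finset.mem_union_left _ hy)).mono (hm y),
      fun y hy => (h y (Finset.mem_union_right _ hy)).mono (hm y)⟩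
  have ha0 := measureReal_nonneg (μ := critical d) (s := {ω | AllReach ω A (t / 2)})
  have hb0 := measureReal_nonneg (μ := critical d) (s := {ω | AllReach ω B (t / 2)})
  have hT0 := arm₂_nonneg (d := d) 1 T
  have ht0 := arm₂_nonneg (d := d) 1 t
  by_cases hcase : T / 2 < (k + 1) * t + 2
  · -- the two scales are comparable and no further arm is needed
    have h1 := H.le_of_le_mul (K := 2 * k + 7) (by omega) ht hT (by
      nlinarith [Nat.div_add_mod T 2, Nat.mod_lt T (by norm_num : 0 < 2)])
    have h2 : (critical d).real {ω | AllReach ω (A ∪ B) (T / 2)} ≤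
        (critical d).real {ω | AllReach ω A (t / 2)} *
          (critical d).real {ω | AllReach ω B (t / 2)} :=
      hAB ▸ measureReal_mono fun ω hω => hsub ω hω
    calc _ ≤ ((critical d).real {ω | AllReach ω A (t / 2)} *
          (critical d).real {ω | AllReach ω B (t / 2)}) *
          (C * ((2 * k + 7 : ℕ) : ℝ) ^ α * arm₂ d 1 T) := by gcongr
      _ ≤ C * (((critical d).real {ω | AllReach ω A (t / 2)} *
          (critical d).real {ω | AllReach ω B (t / 2)}) *
          (C * ((2 * k + 7 : ℕ) : ℝ) ^ α * arm₂ d 1 T)) :=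
        le_mul_of_one_le_left (by positivity) hC
      _ ≤ C * (((critical d).real {ω | AllReach ω A (t / 2)} *
          (critical d).real {ω | AllReach ω B (t / 2)}) *
          (C * ((2 * k + 7 : ℕ) : ℝ) ^ α * arm₂ d 1 T)) +
          C * ((k + 1 : ℕ) : ℝ) ^ α * (C * (C * ((5 : ℕ) : ℝ) ^ α)) *
          ((critical d).real {ω | AllReach ω A (t / 2)} *
          (critical d).real {ω | AllReach ω B (t / 2)} * arm₂ d 1 T) :=
        le_add_of_nonneg_right (by positivity)
      _ = _ := by ring
  · rw [not_lt] at hcase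
    obtain ⟨m, hm⟩ : ∃ m, T / 2 = m + 1 := ⟨T / 2 - 1, by omega⟩
    set l := (k + 1) * t with hl
    have hl1 : 1 ≤ l := by rw [hl]; nlinarith
    have hlm : l ≤ m := by omega
    have hcross : ∀ ω, AllReach ω (A ∪ B) (T / 2) →
        Crosses ω (ball x l : Set (Fin d → ℤ)) (ball x m) := by
      intro ω h
      have h1 := h x (Finset.mem_union_left _ hx)
      rw [hm, openBall_succ] at h1
      refine h1.crosses (fun u hu => ?_) (mem_ball_self x l)
      rw [Finset.mem_coe, mem_ball] at hu ⊢
      omega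
    have hedges : ∀ D : Finset (Fin d → ℤ), D ⊆ A ∪ B →
        reachEdges D (t / 2) ⊆ touch (ball x l : Set (Fin d → ℤ)) := by
      intro D hD
      refine touch_mono fun u hu => ?_
      simp only [Set.mem_iUnion] at hu
      obtain ⟨y, hy, huy⟩ := hu
      have h1 : supNorm (u - y) < t / 2 := huy
      have h2 := hdiam y (hD hy)
      have h3 := supNorm_sub_le u y x
      have h4 : l = k * t + t := by rw [hl]; ring
      rw [Finset.mem_coe, mem_ball]
      omega
    have hABdep : DependsOn (fun ω => AllReach ω A (t / 2) ∧ AllReach ω B (t / 2))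
        (reachEdges A (t / 2) ∪ reachEdges B (t / 2)) := by
      intro ω ω' h
      have h1 := dependsOn_allReach A (t / 2) fun e he => h e (Or.inl he)
      have h2 := dependsOn_allReach B (t / 2) fun e he => h e (Or.inr he)
      simp only at h1 h2 ⊢
      rw [h1, h2]
    have h3 : (critical d).real {ω | (AllReach ω A (t / 2) ∧ AllReach ω B (t / 2)) ∧
          Crosses ω (ball x l : Set (Fin d → ℤ)) (ball x m)} =
        (critical d).real {ω | AllReach ω A (t / 2) ∧ AllReach ω B (t / 2)} *
          (critical d).real {ω | Crosses ω (ball x l : Set (Fin d → ℤ)) (ball x m)} := by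
      refine measureReal_and_of_finite hABdep (dependsOn_crosses _ _)
        ((finite_reachEdges _ _).union (finite_reachEdges _ _))
        ((finite_touch (ball x m).finite_toSet).subset Set.sdiff_subset) ?_
      refine Set.disjoint_left.2 fun e he he' => he'.2 ?_
      exact he.elim (fun h => hedges A Finset.subset_union_left h)
        fun h => hedges B Finset.subset_union_right h
    have h4 : (critical d).real {ω | AllReach ω (A ∪ B) (T / 2)} ≤
        (critical d).real {ω | AllReach ω A (t / 2)} *
          (critical d).real {ω | AllReach ω B (t / 2)} * arm₂ d l m := by
      calc _ ≤ (critical d).real {ω | (AllReach ω A (t / 2) ∧ AllReach ω B (t / 2)) ∧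
          Crosses ω (ball x l : Set (Fin d → ℤ)) (ball x m)} :=
            measureReal_mono fun ω hω => ⟨hsub ω hω, hcross ω hω⟩
        _ ≤ _ := by
          rw [h3, hAB]
          gcongr
          exact measureReal_crosses_le x l m
    -- `π(l, m) π(t) ≤ const · π(l, m) π(l) ≤ const · π(m) ≤ const · π(T)`
    have h5 := H.le_of_le_mul (K := k + 1) (by omega) ht hl1 hl.le
    have h6 := H.annulus l m hl1 hlm
    have h7 := H.le_of_le_mul (K := 5) (m := m) (by norm_num) (by omega) hT (by omega)
    have hlm0 := arm₂_nonneg (d := d) l m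
    have h8 : arm₂ d l m * arm₂ d 1 t ≤
        C * ((k + 1 : ℕ) : ℝ) ^ α * (C * (C * ((5 : ℕ) : ℝ) ^ α)) * arm₂ d 1 T := by
      calc _ ≤ arm₂ d l m * (C * ((k + 1 : ℕ) : ℝ) ^ α * arm₂ d 1 l) := by gcongr
        _ = C * ((k + 1 : ℕ) : ℝ) ^ α * (arm₂ d l m * arm₂ d 1 l) := by ring
        _ ≤ C * ((k + 1 : ℕ) : ℝ) ^ α * (C * (C * ((5 : ℕ) : ℝ) ^ α * arm₂ d 1 T)) := by
          refine mul_le_mul_of_nonneg_left (h6.trans ?_) (by positivity)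
          gcongr
        _ = _ := by ring
    calc _ ≤ ((critical d).real {ω | AllReach ω A (t / 2)} *
          (critical d).real {ω | AllReach ω B (t / 2)} * arm₂ d l m) * arm₂ d 1 t := by gcongr
      _ = ((critical d).real {ω | AllReach ω A (t / 2)} *
          (critical d).real {ω | AllReach ω B (t / 2)}) * (arm₂ d l m * arm₂ d 1 t) := by ring
      _ ≤ ((critical d).real {ω | AllReach ω A (t / 2)} *
          (critical d).real {ω | AllReach ω B (t / 2)}) *
          (C * ((k + 1 : ℕ) : ℝ) ^ α * (C * (C * ((5 : ℕ) : ℝ) ^ α)) * arm₂ d 1 T) := by gcongr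
      _ ≤ C * (C * ((2 * k + 7 : ℕ) : ℝ) ^ α) *
          ((critical d).real {ω | AllReach ω A (t / 2)} *
          (critical d).real {ω | AllReach ω B (t / 2)} * arm₂ d 1 T) +
          ((critical d).real {ω | AllReach ω A (t / 2)} *
          (critical d).real {ω | AllReach ω B (t / 2)}) *
          (C * ((k + 1 : ℕ) : ℝ) ^ α * (C * (C * ((5 : ℕ) : ℝ) ^ α)) * arm₂ d 1 T) :=
        le_add_of_nonneg_left (by positivity)
      _ = _ := by ring

end ArmBounds

/-- A sum over a family of objects is bounded by a sum over the ways of building them. -/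
lemma sum_le_sum_of_exists {ι κ : Type*} {s : Finset ι} {D : Finset κ} {f : ι → ℝ} {g : κ → ℝ}
    (φ : κ → ι) (hg : ∀ δ ∈ D, 0 ≤ g δ) (h : ∀ i ∈ s, ∃ δ ∈ D, φ δ = i ∧ f i ≤ g δ) :
    ∑ i ∈ s, f i ≤ ∑ δ ∈ D, g δ := by
  classical
  calc ∑ i ∈ s, f i ≤ ∑ i ∈ s, ∑ δ ∈ D with φ δ = i, g δ := by
        refine Finset.sum_le_sum fun i hi => ?_
        obtain ⟨δ, hδ, hφ, hf⟩ := h i hi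
        refine hf.trans (Finset.single_le_sum (f := g) (fun δ hδ => hg δ (Finset.mem_filter.1 hδ).1)
          (Finset.mem_filter.2 ⟨hδ, hφ⟩))
    _ ≤ ∑ δ ∈ D, g δ := Finset.sum_fiberwise_le_sum_of_sum_fiber_nonneg fun i _ =>
        Finset.sum_nonneg fun δ hδ => hg δ (Finset.mem_filter.1 hδ).1

/-! ### Factorial moments of fixed order -/

/-- The `k`-point subsets of `W` that contain `x` and are connected at scale `T`. -/
def linkedSets (W : Finset (Fin d → ℤ)) (x : Fin d → ℤ) (k T : ℕ) :
    Finset (Finset (Fin d → ℤ)) :=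
  open Classical in (W.powersetCard k).filter fun S => x ∈ S ∧ Linked T S

lemma mem_linkedSets {W : Finset (Fin d → ℤ)} {x : Fin d → ℤ} {k T : ℕ}
    {S : Finset (Fin d → ℤ)} :
    S ∈ linkedSets W x k T ↔ S ⊆ W ∧ S.card = k ∧ x ∈ S ∧ Linked T S := by
  simp [linkedSets, Finset.mem_powersetCard, and_assoc]

namespace ArmBounds

variable {C α : ℝ} (H : ArmBounds d C α)
include H

/-- The expected number of `k + 1`-point sets around `x` that are connected at scale `T` and all of
whose points have arms of length `T / 2`. In the induction a set is split at its largest gap `t`;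
the arms of the two parts and the long arm contribute `π(t) * π(t) * π(T) / π(t)`, and the sum over
the position of the second part contributes `t ^ (d - 1)`. -/
lemma sum_linkedSets_le (k : ℕ) : ∃ K : ℝ, 0 ≤ K ∧
    ∀ (T : ℕ) (W : Finset (Fin d → ℤ)) (x : Fin d → ℤ), 1 ≤ T →
      ∑ S ∈ linkedSets W x (k + 1) T, (critical d).real {ω | AllReach ω S (T / 2)} ≤
        K * (arm₂ d 1 T * ((T : ℝ) ^ d * arm₂ d 1 T) ^ k) := by
  induction k using Nat.strong_induction_on with
  | _ k ih =>
  rcases Nat.eq_zero_or_pos k with rfl | hk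
  · obtain ⟨K, hK0, hK⟩ := H.measureReal_exits_le
    refine ⟨K, hK0, fun T W x hT => ?_⟩
    calc _ ≤ ∑ S ∈ {({x} : Finset (Fin d → ℤ))}, (critical d).real {ω | AllReach ω S (T / 2)} := by
          refine Finset.sum_le_sum_of_subset_of_nonneg (fun S hS => ?_)
            fun _ _ _ => measureReal_nonneg
          obtain ⟨_, hc, hx, _⟩ := mem_linkedSets.1 hS
          obtain ⟨y, rfl⟩ := Finset.card_eq_one.1 hc
          rw [Finset.mem_singleton] at hx ⊢
          rw [hx]
      _ ≤ _ := by
        simpa [AllReach] using hK x T hT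
  · choose! K hK0 hK using ih
    obtain ⟨K₁, hK₁0, hK₁⟩ := H.measureReal_allReach_union_le k
    obtain ⟨K₂, hK₂0, hK₂⟩ := H.sum_scales_le (k - 1)
    refine ⟨∑ i ∈ Finset.range k,
        K₁ * (K i * (i + 1) * (2 * d * 3 ^ (d - 1)) * K (k - 1 - i)) * K₂,
      Finset.sum_nonneg fun i hi => ?_, fun T W x hT => ?_⟩
    · have hi := Finset.mem_range.1 hi
      have := hK0 i hi
      have := hK0 (k - 1 - i) (by omega)
      positivity
    -- `S` is built from the scale `t` of its largest gap, the part `A ∋ x` with `i + 1` points, the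
    -- pair `(a, b)` across the gap, and the part `B ∋ b`
    set p : ℕ → Finset (Fin d → ℤ) → ℝ := fun t S => (critical d).real {ω | AllReach ω S (t / 2)}
      with hp
    have hp0 : ∀ t S, 0 ≤ p t S := fun _ _ => measureReal_nonneg
    set D := (Finset.Icc 1 T).sigma fun t => (Finset.range k).sigma fun i =>
      (linkedSets W x (i + 1) t).sigma fun A => A.sigma fun a =>
        (W.filter fun b => supNorm (b - a) = t).sigma fun b =>
          linkedSets W b (k - 1 - i + 1) t with hD
    have hmain : ∑ S ∈ linkedSets W x (k + 1) T, p T S ≤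
        ∑ δ ∈ D, K₁ * arm₂ d 1 T * ((arm₂ d 1 δ.1)⁻¹ * (p δ.1 δ.2.2.1 * p δ.1 δ.2.2.2.2.2)) := by
      refine sum_le_sum_of_exists (fun δ => δ.2.2.1 ∪ δ.2.2.2.2.2) ?_ ?_
      · intro δ hδ
        have := arm₂_nonneg (d := d) 1 T
        have := arm₂_nonneg (d := d) 1 δ.1
        have := hp0 δ.1 δ.2.2.1
        have := hp0 δ.1 δ.2.2.2.2.2
        positivity
      · intro S hS
        obtain ⟨hSW, hSc, hxS, hSL⟩ := mem_linkedSets.1 hS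
        obtain ⟨t, A, B, ht1, htT, hxA, rfl, hAB, hLt, hAL, hBL, hgap, a, ha, b, hb, hab⟩ :=
          hSL.exists_split hxS (by omega)
        have hAc : 0 < A.card := Finset.card_pos.2 ⟨x, hxA⟩
        have hBc : 0 < B.card := Finset.card_pos.2 ⟨b, hb⟩
        have hAW := Finset.subset_union_left.trans hSW
        have hBW := Finset.subset_union_right.trans hSW
        rw [Finset.card_union_of_disjoint hAB] at hSc
        refine ⟨⟨t, A.card - 1, A, a, b, B⟩, ?_, rfl, ?_⟩
        · simp only [hD, Finset.mem_sigma, Finset.mem_Icc, Finset.mem_range, mem_linkedSets,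
            Finset.mem_filter]
          exact ⟨⟨ht1, htT⟩, by omega, ⟨hAW, by omega, hxA, hAL⟩, ha, ⟨hBW hb, hab⟩, hBW,
            by omega, hb, hBL⟩
        · have hpos := H.pos t ht1
          have := hK₁ t T x A B ht1 htT hxA (fun y hy => by
            have := hLt.supNorm_le hxS hy
            rwa [Finset.card_union_of_disjoint hAB, hSc, Nat.add_sub_cancel] at this) hgap
          rw [← le_div_iff₀ hpos] at this
          refine this.trans_eq ?_
          simp only [hp]
          field_simp
    refine hmain.trans ?_
    rw [hD]
    simp only [Finset.sum_sigma]
    simp only [← Finset.mul_sum]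
    have hinner : ∀ t ∈ Finset.Icc 1 T, ∀ i ∈ Finset.range k,
        ∑ A ∈ linkedSets W x (i + 1) t, p t A * ∑ a ∈ A, ∑ b ∈ W with supNorm (b - a) = t,
          ∑ B ∈ linkedSets W b (k - 1 - i + 1) t, p t B ≤
        (K i * (i + 1) * (2 * d * 3 ^ (d - 1)) * K (k - 1 - i)) * arm₂ d 1 t *
          ((t : ℝ) ^ (d - 1) * arm₂ d 1 t * ((t : ℝ) ^ d * arm₂ d 1 t) ^ (k - 1)) := by
      intro t ht i hi
      have ht1 := (Finset.mem_Icc.1 ht).1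
      have hi := Finset.mem_range.1 hi
      have hat := arm₂_nonneg (d := d) 1 t
      set j := k - 1 - i with hj
      have hKj := hK0 j (by omega)
      have hKi := hK0 i hi
      set m := (t : ℝ) ^ d * arm₂ d 1 t with hm
      have hm0 : 0 ≤ m := by positivity
      set s : ℝ := 2 * d * 3 ^ (d - 1) * (t : ℝ) ^ (d - 1) with hs
      have hs0 : 0 ≤ s := by positivity
      have hb : ∀ a : Fin d → ℤ,
          ∑ b ∈ W with supNorm (b - a) = t, ∑ B ∈ linkedSets W b (j + 1) t, p t B ≤
          s * (K j * (arm₂ d 1 t * m ^ j)) := by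
        intro a
        refine (Finset.sum_le_sum fun b _ => hK j (by omega) t W b ht1).trans ?_
        rw [Finset.sum_const, nsmul_eq_mul]
        refine mul_le_mul_of_nonneg_right ?_ (by positivity)
        refine (card_filter_supNorm_eq_le W a ht1).trans ?_
        have : (2 * t + 1 : ℝ) ≤ 3 * t := by
          have : (1 : ℝ) ≤ t := by exact_mod_cast ht1
          linarith
        rw [hs, mul_assoc _ (3 ^ (d - 1) : ℝ), ← mul_pow]
        gcongr
      calc _ ≤ ∑ A ∈ linkedSets W x (i + 1) t,
              p t A * ((i + 1) * (s * (K j * (arm₂ d 1 t * m ^ j)))) := by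
            refine Finset.sum_le_sum fun A hA => mul_le_mul_of_nonneg_left ?_ (hp0 t A)
            refine (Finset.sum_le_sum fun a _ => hb a).trans_eq ?_
            rw [Finset.sum_const, nsmul_eq_mul, (mem_linkedSets.1 hA).2.1]
            push_cast
            ring
        _ ≤ (K i * (arm₂ d 1 t * m ^ i)) * ((i + 1) * (s * (K j * (arm₂ d 1 t * m ^ j)))) := by
            rw [← Finset.sum_mul]
            exact mul_le_mul_of_nonneg_right (hK i hi t W x ht1) (by positivity)
        _ = _ := by
            have : m ^ (k - 1) = m ^ i * m ^ j := by rw [← pow_add]; congr 1; omega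
            rw [this, hs]
            ring
    set c : ℕ → ℝ := fun i => K i * (i + 1) * (2 * d * 3 ^ (d - 1)) * K (k - 1 - i) with hc
    have hc0 : ∀ i ∈ Finset.range k, 0 ≤ c i := by
      intro i hi
      have hi := Finset.mem_range.1 hi
      have := hK0 i hi
      have := hK0 (k - 1 - i) (by omega)
      positivity
    have hcs : 0 ≤ ∑ i ∈ Finset.range k, c i := Finset.sum_nonneg hc0
    have hT0 := arm₂_nonneg (d := d) 1 T
    have hk1 : k - 1 + 1 = k := by omega
    have h2 := hK₂ T hT
    rw [hk1] at h2
    calc _ ≤ K₁ * arm₂ d 1 T * ∑ t ∈ Finset.Icc 1 T, (arm₂ d 1 t)⁻¹ * ∑ i ∈ Finset.range k,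
          c i * arm₂ d 1 t *
          ((t : ℝ) ^ (d - 1) * arm₂ d 1 t * ((t : ℝ) ^ d * arm₂ d 1 t) ^ (k - 1)) := by
          refine mul_le_mul_of_nonneg_left (Finset.sum_le_sum fun t ht => ?_) (by positivity)
          exact mul_le_mul_of_nonneg_left (Finset.sum_le_sum fun i hi => hinner t ht i hi)
            (inv_nonneg.2 (arm₂_nonneg 1 t))
      _ = K₁ * arm₂ d 1 T * ((∑ i ∈ Finset.range k, c i) * ∑ t ∈ Finset.Icc 1 T,
          (t : ℝ) ^ (d - 1) * arm₂ d 1 t * ((t : ℝ) ^ d * arm₂ d 1 t) ^ (k - 1)) := by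
          congr 1
          rw [Finset.mul_sum]
          refine Finset.sum_congr rfl fun t ht => ?_
          have := (H.pos t (Finset.mem_Icc.1 ht).1).ne'
          simp only [mul_assoc]
          rw [← Finset.sum_mul]
          field_simp
      _ ≤ K₁ * arm₂ d 1 T * ((∑ i ∈ Finset.range k, c i) *
          (K₂ * ((T : ℝ) ^ d * arm₂ d 1 T) ^ k)) := by gcongr
      _ = _ := by
          rw [← Finset.sum_mul, ← Finset.mul_sum]
          ring

end ArmBounds

/-- The vertices of the box of radius `n` around `z` that are joined to the complement of the
concentric box of radius `2n`. -/
def exitSet (z : Fin d → ℤ) (n : ℕ) (ω : Config d) : Finset (Fin d → ℤ) :=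
  open Classical in (ball z n).filter fun v => Exits ω (ball z (2 * n)) v

lemma mem_exitSet {z v : Fin d → ℤ} {n : ℕ} {ω : Config d} :
    v ∈ exitSet z n ω ↔ v ∈ ball z n ∧ Exits ω (ball z (2 * n)) v := by
  simp [exitSet]

lemma V_eq_exitSet (n : ℕ) (ω : Config d) : V d n ω = exitSet 0 n ω := by
  ext v
  rw [Finset.mem_coe, mem_exitSet, V, Set.mem_ofPred_eq, ← coe_ball_zero, ← coe_ball_zero,
    Finset.mem_coe]
  refine and_congr_right fun hv => connected_singleton_boundary_iff ?_
  rw [Finset.mem_coe, mem_ball] at *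
  omega

lemma ncard_V (n : ℕ) (ω : Config d) : (V d n ω).ncard = (exitSet 0 n ω).card := by
  rw [V_eq_exitSet, Set.ncard_coe_finset]

lemma card_exitSet_le (n : ℕ) (z : Fin d → ℤ) (ω : Config d) :
    (exitSet z n ω).card ≤ (2 * n + 1) ^ d :=
  card_ball z n ▸ Finset.card_le_card fun _ hv => (mem_exitSet.1 hv).1

lemma dependsOn_exitSet (z : Fin d → ℤ) (n : ℕ) :
    DependsOn (exitSet z n) (touch (ball z (2 * n) : Set (Fin d → ℤ))) := by
  intro ω ω' h
  ext v
  rw [mem_exitSet, mem_exitSet]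
  exact and_congr_right fun _ => iff_of_eq (dependsOn_exits _ v h)

lemma DependsOn.comp_left {β γ : Type*} {f : Config d → β} {F : Set (lattice d).edgeSet}
    (hf : DependsOn f F) (g : β → γ) : DependsOn (fun ω => g (f ω)) F :=
  fun _ _ h => congrArg g (hf h)

lemma integrable_of_finite {f : Config d → ℝ} {F : Set (lattice d).edgeSet}
    (hf : DependsOn f F) (hF : F.Finite) : Integrable f (critical d) := by
  lift F to Finset (lattice d).edgeSet using hF
  exact integrable_of_dependsOn hf _

lemma integrable_exitSet (z : Fin d → ℤ) (n : ℕ) (g : Finset (Fin d → ℤ) → ℝ) :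
    Integrable (fun ω => g (exitSet z n ω)) (critical d) :=
  integrable_of_finite (DependsOn.comp_left (dependsOn_exitSet z n) g)
    (finite_touch (ball z (2 * n)).finite_toSet)

lemma linked_of_subset_ball {S : Finset (Fin d → ℤ)} {z : Fin d → ℤ} {n : ℕ}
    (hS : S ⊆ ball z n) : Linked (2 * n) S := by
  intro A hA hne
  obtain ⟨a, ha⟩ := hne
  obtain ⟨b, hb⟩ := Finset.sdiff_nonempty.2 hA.2
  refine ⟨a, ha, b, hb, ?_⟩
  have h1 := mem_ball.1 (hS (hA.1 ha))
  have h2 := mem_ball.1 (hS (Finset.sdiff_subset hb))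
  have h3 := supNorm_sub_le b z a
  rw [supNorm_sub_comm z a] at h3
  omega

lemma integral_choose_eq (n k : ℕ) :
    ∫ ω, (((exitSet (0 : Fin d → ℤ) n ω).card.choose k : ℕ) : ℝ) ∂(critical d) =
      ∑ S ∈ (ball (0 : Fin d → ℤ) n).powersetCard k,
        (critical d).real {ω | S ⊆ exitSet 0 n ω} := by
  classical
  have h1 : ∀ ω : Config d, (((exitSet (0 : Fin d → ℤ) n ω).card.choose k : ℕ) : ℝ) =
      ∑ S ∈ (ball (0 : Fin d → ℤ) n).powersetCard k,
        if S ⊆ exitSet 0 n ω then (1 : ℝ) else 0 := by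
    intro ω
    rw [← Finset.card_powersetCard, Finset.sum_boole]
    congr 2
    ext S
    simp only [Finset.mem_powersetCard, Finset.mem_filter]
    constructor
    · rintro ⟨h, hc⟩
      exact ⟨⟨h.trans fun v hv => (mem_exitSet.1 hv).1, hc⟩, h⟩
    · rintro ⟨⟨_, hc⟩, h⟩
      exact ⟨h, hc⟩
  simp only [h1]
  rw [integral_finsetSum _ fun S _ =>
    integrable_exitSet 0 n fun E => if S ⊆ E then (1 : ℝ) else 0]
  refine Finset.sum_congr rfl fun S _ => ?_
  have hfin := finite_touch (d := d) (ball 0 (2 * n)).finite_toSet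
  have hdep := DependsOn.comp_left (dependsOn_exitSet (0 : Fin d → ℤ) n) fun E => S ⊆ E
  have hm : MeasurableSet {ω : Config d | S ⊆ exitSet 0 n ω} := by
    rw [← hfin.coe_toFinset] at hdep
    exact measurableSet_of_dependsOn hdep
  rw [← integral_indicator_one hm]
  refine integral_congr_ae (Filter.Eventually.of_forall fun ω => ?_)
  by_cases h : S ⊆ exitSet 0 n ω
  · simp [h]
  · simp [h]

/-- Factorial moments of each fixed order; the constant is not uniform in `k`. -/
lemma ArmBounds.integral_choose_le {C α : ℝ} (H : ArmBounds d C α) (k : ℕ) :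
    ∃ K : ℝ, 0 ≤ K ∧ ∀ n : ℕ, 1 ≤ n →
      ∫ ω, (((exitSet (0 : Fin d → ℤ) n ω).card.choose k : ℕ) : ℝ) ∂(critical d) ≤
        K * ((n : ℝ) ^ d * arm₂ d 1 n) ^ k := by
  rcases k with - | k
  · exact ⟨1, zero_le_one, fun n _ => by simp⟩
  obtain ⟨K, hK0, hK⟩ := H.sum_linkedSets_le k
  refine ⟨3 ^ d * K * (2 ^ d) ^ k, by positivity, fun n hn => ?_⟩
  have hn' : (1 : ℝ) ≤ n := by exact_mod_cast hn
  rw [integral_choose_eq]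
  have h1 : ∑ S ∈ (ball (0 : Fin d → ℤ) n).powersetCard (k + 1),
      (critical d).real {ω | S ⊆ exitSet 0 n ω} ≤
      ∑ δ ∈ (ball (0 : Fin d → ℤ) n).sigma fun x => linkedSets (ball 0 n) x (k + 1) (2 * n),
        (critical d).real {ω | AllReach ω δ.2 (2 * n / 2)} := by
    refine sum_le_sum_of_exists (fun δ => δ.2) (fun _ _ => measureReal_nonneg) fun S hS => ?_
    obtain ⟨hSb, hSc⟩ := Finset.mem_powersetCard.1 hS
    obtain ⟨x, hx⟩ := Finset.card_pos.1 (by omega : 0 < S.card)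
    refine ⟨⟨x, S⟩, Finset.mem_sigma.2 ⟨hSb hx, mem_linkedSets.2
      ⟨hSb, hSc, hx, linked_of_subset_ball hSb⟩⟩, rfl, measureReal_mono fun ω hω v hv => ?_⟩
    obtain ⟨hvb, hve⟩ := mem_exitSet.1 (hω hv)
    refine hve.mono fun u hu => ?_
    have h1 : supNorm (u - v) < 2 * n / 2 := hu
    have h2 := supNorm_sub_le u v 0
    rw [mem_ball] at hvb
    rw [Finset.mem_coe, mem_ball]
    omega
  refine h1.trans ?_
  rw [Finset.sum_sigma]
  refine (Finset.sum_le_sum fun x _ => hK (2 * n) (ball 0 n) x (by omega)).trans ?_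
  rw [Finset.sum_const, nsmul_eq_mul, card_ball]
  have ha := arm₂_anti_right (d := d) (k := 1) hn (by omega : n ≤ 2 * n)
  have ha0 := arm₂_nonneg (d := d) 1 (2 * n)
  have han := arm₂_nonneg (d := d) 1 n
  push_cast
  calc _ ≤ (3 * n : ℝ) ^ d * (K * (arm₂ d 1 n * ((2 * n : ℝ) ^ d * arm₂ d 1 n) ^ k)) := by
        gcongr
        linarith
    _ = _ := by
      rw [mul_pow, mul_pow]
      ring

/-! ### Decomposition into independent boxes -/

/-- The generating function of the number of vertices of `Λ_n` that are joined to `∂Λ_{2n}`. -/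
def genFun (d n : ℕ) (s : ℝ) : ℝ :=
  ∫ ω, (1 + s) ^ (exitSet (0 : Fin d → ℤ) n ω).card ∂(critical d)

lemma genFun_mono (n : ℕ) {s t : ℝ} (hs : 0 ≤ s) (hst : s ≤ t) : genFun d n s ≤ genFun d n t := by
  refine integral_mono (integrable_exitSet 0 n fun E => (1 + s) ^ E.card)
    (integrable_exitSet 0 n fun E => (1 + t) ^ E.card) fun ω => ?_
  simp only
  gcongr

lemma one_le_genFun (n : ℕ) {s : ℝ} (hs : 0 ≤ s) : 1 ≤ genFun d n s := by
  have h : ∫ _ω : Config d, (1 : ℝ) ∂(critical d) ≤ genFun d n s := by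
    refine integral_mono (integrable_const _)
      (integrable_exitSet 0 n fun E => (1 + s) ^ E.card) fun ω => ?_
    exact one_le_pow₀ (by linarith)
  simpa using h

lemma exitSet_shift (z : Fin d → ℤ) (n : ℕ) (ω : Config d) :
    (exitSet 0 n (shift z ω)).card = (exitSet z n ω).card := by
  refine Finset.card_bij (fun v _ => v + z) ?_ (fun _ _ _ _ h => add_right_cancel h) ?_
  · intro v hv
    obtain ⟨hvb, w, hw, hr⟩ := mem_exitSet.1 hv
    rw [openGraph_shift_reachable] at hr
    refine mem_exitSet.2 ⟨?_, w + z, fun h => hw ?_, hr⟩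
    · rw [mem_ball] at *
      simpa using hvb
    · rw [Finset.mem_coe, mem_ball] at *
      simpa using h
  · intro v hv
    obtain ⟨hvb, w, hw, hr⟩ := mem_exitSet.1 hv
    refine ⟨v - z, mem_exitSet.2 ⟨?_, w - z, fun h => hw ?_, ?_⟩, sub_add_cancel v z⟩
    · rw [mem_ball] at *
      simpa using hvb
    · rw [Finset.mem_coe, mem_ball] at *
      simpa using h
    · rw [openGraph_shift_reachable]
      simpa using hr

lemma integral_pow_card_exitSet (z : Fin d → ℤ) (n : ℕ) (s : ℝ) :
    ∫ ω, (1 + s) ^ (exitSet z n ω).card ∂(critical d) = genFun d n s := by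
  rw [genFun, critical,
    ← integral_shift z _ fun ω => (1 + s) ^ (exitSet (0 : Fin d → ℤ) n ω).card]
  simp only [exitSet_shift]

/-- The centre of the box with index `y` in the partition of `ℤᵈ` into boxes of radius `r`. -/
def centre (r : ℕ) (y : Fin d → ℤ) : Fin d → ℤ := fun i => (2 * r + 1) * y i

/-- For `v ∈ Λ_n` in the box of radius `r` around `z`, the box of radius `2r` around `z` lies inside
`Λ_{2n}` because `3r ≤ n`, so an arm from `v` to `∂Λ_{2n}` leaves it. -/
lemma card_exitSet_le_sum {n r : ℕ} (hr : 1 ≤ r) (hrn : 3 * r ≤ n) (ω : Config d) :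
    (exitSet (0 : Fin d → ℤ) n ω).card ≤
      ∑ y ∈ ball (0 : Fin d → ℤ) (n / r), (exitSet (centre r y) r ω).card := by
  classical
  refine le_trans (Finset.card_le_card fun v hv => ?_) Finset.card_biUnion_le
  obtain ⟨hvb, w, hw, hr'⟩ := mem_exitSet.1 hv
  rw [mem_ball, sub_zero] at hvb
  rw [Finset.mem_coe, mem_ball, sub_zero] at hw
  set y : Fin d → ℤ := fun i => (v i + r) / (2 * r + 1) with hy
  have hvy : supNorm (v - centre r y) ≤ r := by
    rw [supNorm_le_iff]
    intro i
    have h1 := Int.mul_ediv_add_emod (v i + r) (2 * r + 1)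
    have h2 := Int.emod_nonneg (v i + r) (by omega : (2 * r + 1 : ℤ) ≠ 0)
    have h3 := Int.emod_lt_of_pos (v i + r) (by omega : (0 : ℤ) < 2 * r + 1)
    simp only [Pi.sub_apply, centre, hy]
    omega
  refine Finset.mem_biUnion.2 ⟨y, ?_, mem_exitSet.2 ⟨mem_ball.2 hvy, w, fun h => ?_, hr'⟩⟩
  · rw [mem_ball, sub_zero, supNorm_le_iff]
    intro i
    rw [Nat.le_div_iff_mul_le hr]
    have h1 := natAbs_le_supNorm (v - centre r y) i
    have h2 := natAbs_le_supNorm v i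
    have h3 : ((2 * r + 1) * y i).natAbs ≤ n + r := by
      simp only [Pi.sub_apply, centre] at h1
      omega
    rw [Int.natAbs_mul] at h3
    have h4 : (2 * r + 1 : ℤ).natAbs = 2 * r + 1 := by omega
    rw [h4] at h3
    nlinarith
  · rw [Finset.mem_coe, mem_ball] at h
    have h1 := supNorm_sub_le w (centre r y) v
    rw [supNorm_sub_comm (centre r y) v] at h1
    have h2 := supNorm_add_le (w - v) v
    rw [sub_add_cancel] at h2
    omega

/-- Boxes of radius `2r` whose indices have the same parities are at distance at least `2`. -/
lemma disjoint_touch_centre {r : ℕ} {y y' : Fin d → ℤ} (hne : y ≠ y')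
    (hpar : (fun i => (y i : ZMod 2)) = fun i => (y' i : ZMod 2)) :
    Disjoint (touch (ball (centre r y) (2 * r) : Set (Fin d → ℤ)))
      (touch (ball (centre r y') (2 * r) : Set (Fin d → ℤ))) := by
  refine disjoint_touch fun u hu v hv => ?_
  rw [Finset.mem_coe, mem_ball] at hu hv
  obtain ⟨i, hi⟩ := Function.ne_iff.1 hne
  have h1 : (y i : ZMod 2) = y' i := congrFun hpar i
  rw [ZMod.intCast_eq_intCast_iff] at h1
  obtain ⟨q, hq⟩ := h1.dvd
  have hq0 : 1 ≤ q.natAbs := by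
    rw [Nat.one_le_iff_ne_zero, Int.natAbs_ne_zero]
    rintro rfl
    omega
  have h2 : ((2 * r + 1 : ℤ) * (2 * q)).natAbs = (2 * r + 1) * (2 * q.natAbs) := by
    rw [Int.natAbs_mul, Int.natAbs_mul]
    rfl
  have h3 : (2 * r + 1) * 2 ≤ (2 * r + 1) * (2 * q.natAbs) := Nat.mul_le_mul_left _ (by omega)
  have h4 : centre r y' i - centre r y i = (2 * r + 1 : ℤ) * (2 * q) := by
    simp only [centre]
    push_cast at hq
    rw [← hq]
    ring
  have h5 := natAbs_le_supNorm (u - centre r y) i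
  have h6 := natAbs_le_supNorm (v - centre r y') i
  have h7 := natAbs_le_supNorm (u - v) i
  simp only [Pi.sub_apply] at h5 h6 h7
  omega

/-- The arithmetic-geometric mean inequality, in a form that plays the role of Hölder's inequality
for the product of the contributions of the parity classes. -/
lemma prod_le_inv_card_mul_sum {ι : Type*} [Fintype ι] [Nonempty ι] {b : ι → ℝ}
    (hb : ∀ i, 0 ≤ b i) :
    ∏ i, b i ≤ (Fintype.card ι : ℝ)⁻¹ * ∑ i, b i ^ Fintype.card ι := by
  have hc : Fintype.card ι ≠ 0 := Fintype.card_ne_zero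
  have hc' : (Fintype.card ι : ℝ) ≠ 0 := by exact_mod_cast hc
  have h := Real.geom_mean_le_arith_mean_weighted Finset.univ
    (fun _ : ι => (Fintype.card ι : ℝ)⁻¹) (fun i => b i ^ Fintype.card ι) (fun _ _ => by positivity)
    (by simp [hc']) fun i _ => pow_nonneg (hb i) _
  rw [Finset.mul_sum]
  refine le_trans (le_of_eq (Finset.prod_congr rfl fun i _ => ?_)) h
  rw [Real.pow_rpow_inv_natCast (hb i) hc]

/-- On `[0, 1]` the convex function `s ↦ (1 + s) ^ N` lies below its chord. -/
lemma one_add_pow_le {s : ℝ} (hs : 0 ≤ s) (hs1 : s ≤ 1) (N : ℕ) :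
    (1 + s) ^ N ≤ 1 + (2 ^ N - 1) * s := by
  induction N with
  | zero => simp
  | succ N ih =>
    have h1 : (1 : ℝ) ≤ 2 ^ N := one_le_pow₀ (by norm_num)
    have h2 : s * s ≤ s := mul_le_of_le_one_left hs hs1
    calc (1 + s) ^ (N + 1) = (1 + s) * (1 + s) ^ N := by ring
      _ ≤ (1 + s) * (1 + (2 ^ N - 1) * s) := by gcongr
      _ = 1 + 2 ^ N * s + (2 ^ N - 1) * (s * s) := by ring
      _ ≤ 1 + 2 ^ N * s + (2 ^ N - 1) * s := by
        have := mul_le_mul_of_nonneg_left h2 (sub_nonneg.2 h1)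
        linarith
      _ = _ := by ring

/-- The boxes of radius `r` in one parity class contribute independently. The factor `2 ^ 2 ^ d`
comes from raising `1 + s` to the number `2 ^ d` of classes. -/
lemma genFun_le_genFun_pow {n r : ℕ} (hr : 1 ≤ r) (hrn : 3 * r ≤ n) {s : ℝ} (hs : 0 ≤ s)
    (hs1 : s ≤ 1) :
    genFun d n s ≤ genFun d r (2 ^ 2 ^ d * s) ^ (2 * (n / r) + 1) ^ d := by
  classical
  set par : (Fin d → ℤ) → (Fin d → ZMod 2) := fun y i => (y i : ZMod 2) with hpar
  set Y := ball (0 : Fin d → ℤ) (n / r) with hY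
  set X : (Fin d → ℤ) → Config d → ℕ := fun y ω => (exitSet (centre r y) r ω).card with hX
  have hcard : Fintype.card (Fin d → ZMod 2) = 2 ^ d := by simp [ZMod.card]
  set s' : ℝ := (1 + s) ^ 2 ^ d - 1 with hs'
  have hs'0 : 0 ≤ s' := by
    have : 1 ≤ (1 + s) ^ 2 ^ d := one_le_pow₀ (by linarith)
    linarith
  have hs's : s' ≤ 2 ^ 2 ^ d * s := by
    have := one_add_pow_le hs hs1 (2 ^ d)
    have h2 : (2 ^ 2 ^ d - 1) * s ≤ 2 ^ 2 ^ d * s := by linarith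
    linarith
  have hpt : ∀ ω, (1 + s) ^ (exitSet (0 : Fin d → ℤ) n ω).card ≤
      ((2 ^ d : ℕ) : ℝ)⁻¹ * ∑ c, ∏ y ∈ Y with par y = c, (1 + s') ^ X y ω := by
    intro ω
    calc _ ≤ (1 + s) ^ ∑ y ∈ Y, X y ω :=
          pow_le_pow_right₀ (by linarith) (card_exitSet_le_sum hr hrn ω)
      _ = ∏ c, (1 + s) ^ ∑ y ∈ Y with par y = c, X y ω := by
          rw [Finset.prod_pow_eq_pow_sum, Finset.sum_fiberwise]
      _ ≤ _ := prod_le_inv_card_mul_sum fun c => by positivity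
      _ = _ := by
          rw [hcard]
          refine congrArg _ (Finset.sum_congr rfl fun c _ => ?_)
          rw [Finset.prod_pow_eq_pow_sum, ← pow_mul, mul_comm, pow_mul, hs', add_sub_cancel]
  have hfin : ∀ y : Fin d → ℤ, (touch (ball (centre r y) (2 * r) : Set (Fin d → ℤ))).Finite :=
    fun y => finite_touch (Finset.finite_toSet _)
  have hdep : ∀ y : Fin d → ℤ, DependsOn (fun ω => (1 + s') ^ X y ω)
      (touch (ball (centre r y) (2 * r) : Set (Fin d → ℤ))) := fun y =>
    DependsOn.comp_left (dependsOn_exitSet (centre r y) r) fun E => (1 + s') ^ E.card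
  have hint : ∀ c, Integrable (fun ω => ∏ y ∈ Y with par y = c, (1 + s') ^ X y ω)
      (critical d) := by
    intro c
    exact integrable_of_finite (DependsOn.finset_prod fun y _ => hdep y)
      (Finset.finite_toSet _ |>.biUnion fun y _ => hfin y)
  have hprod : ∀ c, ∫ ω, ∏ y ∈ Y with par y = c, (1 + s') ^ X y ω ∂(critical d) ≤
      genFun d r s' ^ (2 * (n / r) + 1) ^ d := by
    intro c
    have h := integral_prod_of_dependsOn (s := Y.filter fun y => par y = c)
      (f := fun y ω => (1 + s') ^ X y ω) (F := fun y => (hfin y).toFinset)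
      (fun y _ => by rw [Set.Finite.coe_toFinset]; exact hdep y) (by
        intro y hy y' hy' hne
        rw [Finset.mem_coe, Finset.mem_filter] at hy hy'
        rw [Function.onFun, Set.Finite.disjoint_toFinset]
        exact disjoint_touch_centre hne (hy.2.trans hy'.2.symm)) (pc d)
    rw [critical, h]
    have h2 : ∀ y, ∫ ω, (1 + s') ^ X y ω ∂(perc d (pc d)) = genFun d r s' := fun y =>
      integral_pow_card_exitSet (centre r y) r s'
    simp only [h2, Finset.prod_const]
    refine pow_le_pow_right₀ (one_le_genFun r hs'0) ?_
    rw [← card_ball (0 : Fin d → ℤ) (n / r)]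
    exact Finset.card_filter_le _ _
  calc genFun d n s ≤ ∫ ω, ((2 ^ d : ℕ) : ℝ)⁻¹ * ∑ c, ∏ y ∈ Y with par y = c, (1 + s') ^ X y ω
        ∂(critical d) :=
        integral_mono (integrable_exitSet 0 n fun E => (1 + s) ^ E.card)
          ((integrable_finsetSum _ fun c _ => hint c).const_mul _) hpt
    _ = ((2 ^ d : ℕ) : ℝ)⁻¹ *
        ∑ c, ∫ ω, ∏ y ∈ Y with par y = c, (1 + s') ^ X y ω ∂(critical d) := by
        rw [integral_const_mul, integral_finsetSum _ fun c _ => hint c]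
    _ ≤ ((2 ^ d : ℕ) : ℝ)⁻¹ * ∑ _c : Fin d → ZMod 2, genFun d r s' ^ (2 * (n / r) + 1) ^ d := by
        gcongr with c
        exact hprod c
    _ = genFun d r s' ^ (2 * (n / r) + 1) ^ d := by
        rw [Finset.sum_const, Finset.card_univ, hcard, nsmul_eq_mul, ← mul_assoc,
          inv_mul_cancel₀ (by positivity), one_mul]
    _ ≤ _ := by
        have := one_le_genFun (d := d) r hs'0
        gcongr
        exact genFun_mono r hs'0 hs's

/-! ### Uniform exponential moments -/

/-- Halving `s` in `(1 + s) ^ X` leaves the low-order terms of the expansion and shrinks the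
rest. -/
lemma one_add_half_pow_le {s : ℝ} (hs : 0 ≤ s) (X m : ℕ) :
    (1 + s / 2) ^ X ≤
      ∑ j ∈ Finset.range m, s ^ j * (X.choose j : ℝ) + (1 / 2) ^ m * (1 + s) ^ X := by
  have h1 : ∀ j, (s / 2) ^ j * (X.choose j : ℝ) ≤
      (if j < m then s ^ j * (X.choose j : ℝ) else 0) +
        (1 / 2) ^ m * (s ^ j * (X.choose j : ℝ)) := by
    intro j
    have h0 : 0 ≤ s ^ j * (X.choose j : ℝ) := by positivity
    have e : (s / 2) ^ j * (X.choose j : ℝ) = (1 / 2) ^ j * (s ^ j * (X.choose j : ℝ)) := by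
      rw [div_pow, one_div, inv_pow]; ring
    rw [e]
    split_ifs with hj
    · have h2 : ((1 : ℝ) / 2) ^ j ≤ 1 := pow_le_one₀ (by norm_num) (by norm_num)
      have h3 := mul_le_of_le_one_left h0 h2
      have h4 : 0 ≤ ((1 : ℝ) / 2) ^ m * (s ^ j * (X.choose j : ℝ)) := by positivity
      linarith
    · rw [zero_add]
      refine mul_le_mul_of_nonneg_right ?_ h0
      exact pow_le_pow_of_le_one (by norm_num) (by norm_num) (by omega)
  calc (1 + s / 2) ^ X = ∑ j ∈ Finset.range (X + 1), (s / 2) ^ j * (X.choose j : ℝ) := by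
        rw [add_comm, add_pow]
        simp
    _ ≤ ∑ j ∈ Finset.range (X + 1), ((if j < m then s ^ j * (X.choose j : ℝ) else 0) +
        (1 / 2) ^ m * (s ^ j * (X.choose j : ℝ))) := Finset.sum_le_sum fun j _ => h1 j
    _ = ∑ j ∈ Finset.range (X + 1) with j < m, s ^ j * (X.choose j : ℝ) +
        (1 / 2) ^ m * (1 + s) ^ X := by
        rw [Finset.sum_add_distrib, ← Finset.sum_filter, ← Finset.mul_sum, add_comm 1 s, add_pow]
        simp
    _ ≤ _ := by
        gcongr
        exact fun j hj => Finset.mem_range.2 (Finset.mem_filter.1 hj).2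

lemma genFun_half_le (n m : ℕ) {s : ℝ} (hs : 0 ≤ s) :
    genFun d n (s / 2) ≤
      ∑ j ∈ Finset.range m,
        s ^ j * ∫ ω, (((exitSet (0 : Fin d → ℤ) n ω).card.choose j : ℕ) : ℝ) ∂(critical d) +
      (1 / 2) ^ m * genFun d n s := by
  have i1 : ∀ j, Integrable (fun ω => s ^ j *
      (((exitSet (0 : Fin d → ℤ) n ω).card.choose j : ℕ) : ℝ)) (critical d) := fun j =>
    integrable_exitSet 0 n fun E => s ^ j * ((E.card.choose j : ℕ) : ℝ)
  have i2 : Integrable (fun ω => (1 / 2 : ℝ) ^ m * (1 + s) ^ (exitSet (0 : Fin d → ℤ) n ω).card)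
      (critical d) := integrable_exitSet 0 n fun E => (1 / 2 : ℝ) ^ m * (1 + s) ^ E.card
  calc genFun d n (s / 2) ≤ ∫ ω, (∑ j ∈ Finset.range m, s ^ j *
        (((exitSet (0 : Fin d → ℤ) n ω).card.choose j : ℕ) : ℝ) +
          (1 / 2 : ℝ) ^ m * (1 + s) ^ (exitSet (0 : Fin d → ℤ) n ω).card) ∂(critical d) :=
        integral_mono (integrable_exitSet 0 n fun E => (1 + s / 2) ^ E.card)
          ((integrable_finsetSum _ fun j _ => i1 j).add i2) fun ω => one_add_half_pow_le hs _ m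
    _ = _ := by
        rw [integral_add (integrable_finsetSum _ fun j _ => i1 j) i2,
          integral_finsetSum _ fun j _ => i1 j, integral_const_mul]
        simp only [integral_const_mul]
        rfl

lemma exp_half_le_two : Real.exp (1 / 2) ≤ 2 := by
  have h := Real.one_sub_le_exp_neg (1 / 2)
  rw [Real.exp_neg, le_inv_comm₀ (by norm_num) (Real.exp_pos _)] at h
  norm_num at h ⊢
  exact h

namespace ArmBounds

variable {C α : ℝ} (H : ArmBounds d C α)
include H

/-- The number of vertices of `Λ_n` joined to `∂Λ_{2n}` has uniformly bounded exponential moments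
on the scale `n ^ d π(n)`. The bound is passed from scale `n / K` to scale `n`: there are boundedly
many boxes, the moments of order at most `m` are controlled directly, and in the terms of
order above `m` the change of normalisation gains a factor `2 ^ (-m)`. -/
lemma exists_genFun_le_two : ∃ θ : ℝ, 0 < θ ∧ θ * C ≤ 1 ∧ ∀ n : ℕ, 1 ≤ n →
    genFun d n (θ / ((n : ℝ) ^ d * arm₂ d 1 n)) ≤ 2 := by
  have hC1 := H.one_le
  have hC : 0 < C := by linarith
  have hβ : 0 < (d : ℝ) - α := sub_pos.2 H.lt_dim
  obtain ⟨K, hK3, hK⟩ : ∃ K : ℕ, 3 ≤ K ∧ 2 * 2 ^ 2 ^ d * C ≤ (K : ℝ) ^ ((d : ℝ) - α) := by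
    have h := (tendsto_rpow_atTop hβ).comp (tendsto_natCast_atTop_atTop (R := ℝ))
    obtain ⟨K, h1, h2⟩ := ((Filter.eventually_ge_atTop 3).and
      (h.eventually_ge_atTop (2 * 2 ^ 2 ^ d * C))).exists
    exact ⟨K, h1, h2⟩
  have hK0 : (0 : ℝ) < K := by positivity
  set N : ℝ := (4 * K : ℝ) ^ d with hN
  have hN1 : 1 ≤ N := one_le_pow₀ (by
    have : (3 : ℝ) ≤ K := by exact_mod_cast hK3
    linarith)
  obtain ⟨m, hm⟩ : ∃ m : ℕ, (1 / 2 : ℝ) ^ m < 1 / (4 * N) :=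
    exists_pow_lt_of_lt_one (by positivity) (by norm_num)
  choose M hM0 hM using H.integral_choose_le
  set B : ℝ := ∑ j ∈ Finset.range m, M (j + 1) with hB
  have hB0 : 0 ≤ B := Finset.sum_nonneg fun j _ => hM0 _
  set θ : ℝ := 1 / (4 * N * (B + 1) * C) with hθ
  have hθ0 : 0 < θ := by positivity
  have hθC : θ * C * (4 * N * (B + 1)) = 1 := by rw [hθ]; field_simp
  have hθN : θ * C * (4 * N) ≤ 1 := by
    rw [← hθC]
    have : 0 ≤ θ * C * (4 * N) * B := by positivity
    linarith
  have hθC1 : θ * C ≤ 1 := by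
    refine le_trans (le_mul_of_one_le_right (by positivity) ?_) hθN
    linarith
  have hθ1 : θ ≤ 1 := le_trans (le_mul_of_one_le_right hθ0.le hC1) hθC1
  have hθB : θ * B * N ≤ 1 / 4 := by
    have h1 : θ * B * N ≤ θ * C * N * (B + 1) := by
      calc θ * B * N = θ * 1 * N * B := by ring
        _ ≤ θ * C * N * (B + 1) := by gcongr; linarith
    linarith
  clear_value θ
  refine ⟨θ, hθ0, hθC1, fun n => ?_⟩
  induction n using Nat.strong_induction_on with
  | _ n ih =>
  intro hn
  have hn0 : (0 : ℝ) < n := by exact_mod_cast hn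
  have hμC : ∀ r : ℕ, 1 ≤ r → θ / ((r : ℝ) ^ d * arm₂ d 1 r) ≤ θ * C := by
    intro r hr
    rw [div_eq_mul_inv]
    exact mul_le_mul_of_nonneg_left (inv_le_of_inv_le₀ hC (H.le_volume hr)) hθ0.le
  have hμ0 : ∀ r : ℕ, 1 ≤ r → 0 < (r : ℝ) ^ d * arm₂ d 1 r := fun r hr =>
    (inv_pos.2 hC).trans_le (H.le_volume hr)
  rcases lt_or_ge n K with hnK | hnK
  · -- at bounded scales the number of vertices is bounded
    have h1 : ∀ ω : Config d, (1 + θ / ((n : ℝ) ^ d * arm₂ d 1 n)) ^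
        (exitSet (0 : Fin d → ℤ) n ω).card ≤ 2 := by
      intro ω
      have h2 : ((exitSet (0 : Fin d → ℤ) n ω).card : ℝ) ≤ N := by
        have h3 : ((exitSet (0 : Fin d → ℤ) n ω).card : ℝ) ≤ ((2 * n + 1) ^ d : ℕ) := by
          exact_mod_cast card_exitSet_le n 0 ω
        refine h3.trans ?_
        have : (n : ℝ) + 1 ≤ K := by exact_mod_cast hnK
        push_cast
        rw [hN]
        gcongr
        linarith
      have h4 := hμC n hn
      have h5 : 0 ≤ θ / ((n : ℝ) ^ d * arm₂ d 1 n) := (div_pos hθ0 (hμ0 n hn)).le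
      calc _ ≤ (Real.exp (θ * C)) ^ (exitSet (0 : Fin d → ℤ) n ω).card := by
            gcongr
            linarith [Real.add_one_le_exp (θ * C)]
        _ = Real.exp ((exitSet (0 : Fin d → ℤ) n ω).card * (θ * C)) := (Real.exp_nat_mul _ _).symm
        _ ≤ Real.exp (1 / 2) := by
            rw [Real.exp_le_exp]
            have := mul_le_mul_of_nonneg_right h2 (mul_nonneg hθ0.le hC.le)
            linarith
        _ ≤ 2 := exp_half_le_two
    have h3 := integral_mono (μ := critical d) (integrable_exitSet 0 n fun E =>
      (1 + θ / ((n : ℝ) ^ d * arm₂ d 1 n)) ^ E.card) (integrable_const (2 : ℝ)) h1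
    simpa [genFun] using h3
  · set r := n / K with hr
    have hr1 : 1 ≤ r := Nat.div_pos hnK (by omega)
    have hrK : r * K ≤ n := Nat.div_mul_le_self n K
    have hrn : r ≤ n := Nat.div_le_self n K
    have hr3 : 3 * r ≤ n := by nlinarith
    have hnr : n / r < 2 * K := by
      rw [Nat.div_lt_iff_lt_mul hr1]
      have := Nat.lt_mul_div_succ n (by omega : 0 < K)
      rw [← hr] at this
      nlinarith
    set μr := (r : ℝ) ^ d * arm₂ d 1 r with hμr
    set μn := (n : ℝ) ^ d * arm₂ d 1 n with hμn
    have hμr0 : 0 < μr := hμ0 r hr1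
    have hμn0 : 0 < μn := hμ0 n hn
    have hμ : 2 * 2 ^ 2 ^ d * μr ≤ μn := by
      have h1 := H.volume_le_rpow_mul hr1 hrn
      have h2 : ((r : ℝ) / n) ^ ((d : ℝ) - α) ≤ ((K : ℝ) ^ ((d : ℝ) - α))⁻¹ := by
        rw [← Real.inv_rpow hK0.le]
        refine Real.rpow_le_rpow (by positivity) ?_ hβ.le
        rw [div_le_iff₀ hn0, le_inv_mul_iff₀ hK0]
        have : (r : ℝ) * K ≤ n := by exact_mod_cast hrK
        linarith
      have hKβ : 0 < (K : ℝ) ^ ((d : ℝ) - α) := Real.rpow_pos_of_pos hK0 _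
      calc 2 * 2 ^ 2 ^ d * μr ≤ 2 * 2 ^ 2 ^ d * (C * ((K : ℝ) ^ ((d : ℝ) - α))⁻¹ * μn) := by
            gcongr
            exact h1.trans (by gcongr)
        _ = (2 * 2 ^ 2 ^ d * C) * ((K : ℝ) ^ ((d : ℝ) - α))⁻¹ * μn := by ring
        _ ≤ (K : ℝ) ^ ((d : ℝ) - α) * ((K : ℝ) ^ ((d : ℝ) - α))⁻¹ * μn := by gcongr
        _ = μn := by rw [mul_inv_cancel₀ hKβ.ne', one_mul]
    have hs : 2 ^ 2 ^ d * (θ / μn) ≤ θ / μr / 2 := by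
      rw [div_div, ← mul_div_assoc, div_le_div_iff₀ hμn0 (by positivity)]
      have := mul_le_mul_of_nonneg_left hμ hθ0.le
      linarith
    have hmom : genFun d r (θ / μr / 2) ≤ 1 + (θ * B + 1 / (4 * N)) := by
      refine (genFun_half_le r (m + 1) (div_pos hθ0 hμr0).le).trans ?_
      rw [Finset.sum_range_succ']
      have h1 : ∀ j ∈ Finset.range m, (θ / μr) ^ (j + 1) *
          ∫ ω, (((exitSet (0 : Fin d → ℤ) r ω).card.choose (j + 1) : ℕ) : ℝ) ∂(critical d) ≤
          θ * M (j + 1) := by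
        intro j _
        have h2 := hM (j + 1) r hr1
        have h3 : θ ^ (j + 1) ≤ θ := pow_le_of_le_one hθ0.le hθ1 (by omega)
        calc _ ≤ (θ / μr) ^ (j + 1) * (M (j + 1) * μr ^ (j + 1)) := by gcongr
          _ = θ ^ (j + 1) * M (j + 1) := by
            rw [div_pow]
            field_simp
          _ ≤ _ := mul_le_mul_of_nonneg_right h3 (hM0 _)
      have h2 := Finset.sum_le_sum h1
      rw [← Finset.mul_sum, ← hB] at h2
      have h3 : (1 / 2 : ℝ) ^ (m + 1) * genFun d r (θ / μr) ≤ 1 / (4 * N) := by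
        have h4 := ih r (Nat.div_lt_self hn (by omega)) hr1
        calc _ ≤ (1 / 2 : ℝ) ^ (m + 1) * 2 := by gcongr
          _ = (1 / 2 : ℝ) ^ m := by ring
          _ ≤ _ := hm.le
      simp only [pow_zero, Nat.choose_zero_right, Nat.cast_one, integral_const,
        probReal_univ, smul_eq_mul, mul_one]
      linarith
    have hε : 0 ≤ θ * B + 1 / (4 * N) := by positivity
    calc genFun d n (θ / μn) ≤ genFun d r (2 ^ 2 ^ d * (θ / μn)) ^ (2 * (n / r) + 1) ^ d :=
          genFun_le_genFun_pow hr1 hr3 (div_pos hθ0 hμn0).le ((hμC n hn).trans hθC1)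
      _ ≤ (1 + (θ * B + 1 / (4 * N))) ^ (2 * (n / r) + 1) ^ d := by
          have h0 : 0 ≤ 2 ^ 2 ^ d * (θ / μn) := by positivity
          have := one_le_genFun (d := d) r h0
          gcongr
          exact (genFun_mono r h0 hs).trans hmom
      _ ≤ (Real.exp (θ * B + 1 / (4 * N))) ^ (2 * (n / r) + 1) ^ d := by
          gcongr
          linarith [Real.add_one_le_exp (θ * B + 1 / (4 * N))]
      _ = Real.exp (((2 * (n / r) + 1) ^ d : ℕ) * (θ * B + 1 / (4 * N))) :=
          (Real.exp_nat_mul _ _).symm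
      _ ≤ Real.exp (1 / 2) := by
          rw [Real.exp_le_exp]
          have h1 : (((2 * (n / r) + 1) ^ d : ℕ) : ℝ) ≤ N := by
            have : (((2 * (n / r) + 1) ^ d : ℕ) : ℝ) ≤ (((4 * K) ^ d : ℕ) : ℝ) := by
              exact_mod_cast Nat.pow_le_pow_left (by omega) d
            rw [hN]
            exact_mod_cast this
          have h2 : N * (θ * B + 1 / (4 * N)) = θ * B * N + 1 / 4 := by
            field_simp
          have h3 := mul_le_mul_of_nonneg_right h1 hε
          linarith
      _ ≤ 2 := exp_half_le_two

/-- The exponential moment at scale `n`, with the normalisation of a smaller scale `r`, costs a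
constant factor for each box of radius `r`. -/
lemma exists_genFun_le_two_pow : ∃ θ : ℝ, 0 < θ ∧ ∀ n r : ℕ, 1 ≤ r → 3 * r ≤ n →
    θ / ((r : ℝ) ^ d * arm₂ d 1 r) ≤ 1 ∧
    genFun d n (θ / ((r : ℝ) ^ d * arm₂ d 1 r)) ≤ 2 ^ (2 * (n / r) + 1) ^ d := by
  obtain ⟨θ, hθ0, hθC, hθ⟩ := H.exists_genFun_le_two
  have hC : 0 < C := by linarith [H.one_le]
  refine ⟨θ / 2 ^ 2 ^ d, by positivity, fun n r hr hrn => ?_⟩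
  have hμ : 0 < (r : ℝ) ^ d * arm₂ d 1 r := (inv_pos.2 hC).trans_le (H.le_volume hr)
  have h1 : (1 : ℝ) ≤ 2 ^ 2 ^ d := one_le_pow₀ (by norm_num)
  have h2 : θ / ((r : ℝ) ^ d * arm₂ d 1 r) ≤ 1 := by
    rw [div_eq_mul_inv]
    exact (mul_le_mul_of_nonneg_left (inv_le_of_inv_le₀ hC (H.le_volume hr)) hθ0.le).trans hθC
  have h3 : θ / 2 ^ 2 ^ d / ((r : ℝ) ^ d * arm₂ d 1 r) ≤ 1 := by
    rw [div_right_comm]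
    exact (div_le_self (by positivity) h1).trans h2
  refine ⟨h3, (genFun_le_genFun_pow hr hrn (by positivity) h3).trans ?_⟩
  have h4 : 2 ^ 2 ^ d * (θ / 2 ^ 2 ^ d / ((r : ℝ) ^ d * arm₂ d 1 r)) =
      θ / ((r : ℝ) ^ d * arm₂ d 1 r) := by
    field_simp
  rw [h4]
  have := one_le_genFun (d := d) r (s := θ / ((r : ℝ) ^ d * arm₂ d 1 r)) (by positivity)
  gcongr
  exact hθ r hr

end ArmBounds

/-! ### Factorial moments of all orders and the tail of `|V_n|` -/

lemma measureReal_open_eq (e e' : (lattice d).edgeSet) (p : unitInterval) :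
    (perc d p).real {ω | ω e = true} = (perc d p).real {ω | ω e' = true} := by
  have h : ∀ e : (lattice d).edgeSet, (perc d p).real {ω | ω e = true} =
      (bernoulliMeasure true false p).real {true} := by
    intro e
    have h1 := Measure.infinitePi_map_eval
      (fun _ : (lattice d).edgeSet => bernoulliMeasure true false p) e
    simp only [measureReal_def]
    rw [← h1, Measure.map_apply (measurable_pi_apply e) (MeasurableSet.singleton true)]
    rfl
  rw [h e, h e']

/-- If there were no arm from `∂Λ_1` to `∂Λ_0` then all edges would almost surely be closed.
This positivity serves the case `k > n ^ d` of the moment bound, in which `n / k ^ (1 / d)` has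
integer part `0`. -/
lemma arm₂_one_zero_pos (hd : 1 ≤ d) (h2 : 0 < arm₂ d 1 2) : 0 < arm₂ d 1 0 := by
  by_contra h0
  -- the edge between `e₁` and `2e₁` joins `∂Λ_0` to `∂Λ_1`
  let i₀ : Fin d := ⟨0, hd⟩
  have hadj : ∀ a : ℤ, (lattice d).Adj (Pi.single i₀ a) (Pi.single i₀ (a + 1)) := by
    intro a
    change ∑ i, |(Pi.single i₀ a : Fin d → ℤ) i - (Pi.single i₀ (a + 1) : Fin d → ℤ) i| = 1
    rw [Finset.sum_eq_single i₀]
    · simp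
    · intro i _ hi
      simp [Pi.single_eq_of_ne hi]
    · simp
  have hbd : ∀ n : ℕ, Pi.single i₀ ((n : ℤ) + 1) ∈ boundary (box d n) := by
    intro n
    refine ⟨fun h => ?_, Pi.single i₀ (n : ℤ), fun i => ?_, hadj n⟩
    · have := h i₀
      rw [Pi.single_eq_same] at this
      rw [abs_of_nonneg (by positivity)] at this
      omega
    · rcases eq_or_ne i i₀ with rfl | hi
      · simp
      · simp [Pi.single_eq_of_ne hi]
  let e₀ : (lattice d).edgeSet := ⟨s(Pi.single i₀ 1, Pi.single i₀ (1 + 1)), hadj 1⟩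
  have he₀ : (critical d).real {ω | ω e₀ = true} ≤ arm₂ d 1 0 := by
    refine measureReal_mono fun ω hω => ?_
    refine ⟨Pi.single i₀ (1 + 1), ?_, Pi.single i₀ 1, ?_, ?_⟩
    · simpa using hbd 1
    · simpa using hbd 0
    · exact (SimpleGraph.Adj.reachable (G := openGraph ω) ⟨hadj 1, hω⟩).symm
  have hall : ∀ e : (lattice d).edgeSet, critical d {ω | ω e = true} = 0 := by
    intro e
    have h1 : (critical d).real {ω | ω e = true} = 0 := by
      refine le_antisymm ?_ measureReal_nonneg
      rw [critical, measureReal_open_eq e e₀]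
      exact he₀.trans (not_lt.1 h0)
    rwa [measureReal_def, ENNReal.toReal_eq_zero_iff, or_iff_left (measure_ne_top _ _)] at h1
  have hnull : critical d (⋃ e : (lattice d).edgeSet, {ω | ω e = true}) = 0 :=
    measure_iUnion_null hall
  have hsub : {ω : Config d | Connected ω (boundary (box d 1)) (boundary (box d 2))} ⊆
      ⋃ e : (lattice d).edgeSet, {ω | ω e = true} := by
    rintro ω ⟨v, ⟨_, u, hu, huv⟩, w, hw, ⟨p⟩⟩
    cases p with
    | nil =>
      -- `∂Λ_1` and `∂Λ_2` are disjoint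
      refine absurd ?_ hw.1
      rw [← coe_ball_zero, Finset.mem_coe, mem_ball] at hu ⊢
      have h1 := supNorm_le_one_of_adj huv.symm
      have h3 := supNorm_sub_le v u 0
      omega
    | cons h _ =>
      obtain ⟨hl, ho⟩ := h
      exact Set.mem_iUnion.2 ⟨_, ho⟩
  have := measure_mono_null hsub hnull
  rw [arm₂, measureReal_def, this] at h2
  simp at h2

lemma choose_le_pow_mul {s : ℝ} (hs : 0 < s) (X k : ℕ) :
    (X.choose k : ℝ) ≤ (s⁻¹) ^ k * (1 + s) ^ X := by
  rcases le_or_gt k X with hk | hk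
  · have h : s ^ k * (X.choose k : ℝ) ≤ (1 + s) ^ X := by
      rw [add_comm 1 s, add_pow]
      simp only [one_pow, mul_one]
      exact Finset.single_le_sum (f := fun j => s ^ j * (X.choose j : ℝ))
        (fun j _ => by positivity) (Finset.mem_range.2 (by omega))
    rw [inv_pow, le_inv_mul_iff₀ (by positivity)]
    exact h
  · rw [Nat.choose_eq_zero_of_lt hk]
    simp only [Nat.cast_zero]
    positivity

lemma exp_half_mul_le {s : ℝ} (hs : 0 ≤ s) (hs1 : s ≤ 1) : Real.exp (s / 2) ≤ 1 + s := by
  have h := Real.one_sub_le_exp_neg (s / 2)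
  rw [Real.exp_neg, le_inv_comm₀ (by linarith) (Real.exp_pos _)] at h
  refine h.trans ?_
  rw [inv_le_iff_one_le_mul₀ (by linarith)]
  nlinarith

lemma two_le_exp_one : (2 : ℝ) ≤ Real.exp 1 := by
  have := Real.add_one_le_exp (1 : ℝ)
  linarith

/-- Boxes of radius `r = ⌊x / 3⌋`, for `x ≥ 3`. -/
lemma floor_third_bounds {x : ℝ} (hx : 3 ≤ x) :
    1 ≤ ⌊x / 3⌋₊ ∧ ((⌊x / 3⌋₊ : ℕ) : ℝ) ≤ x / 3 ∧ x ≤ 6 * ((⌊x / 3⌋₊ : ℕ) : ℝ) := by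
  have h1 : 1 ≤ ⌊x / 3⌋₊ := Nat.le_floor (by push_cast; linarith)
  have h2 := Nat.floor_le (by linarith : 0 ≤ x / 3)
  have h3 := Nat.lt_floor_add_one (x / 3)
  have h4 : (1 : ℝ) ≤ (⌊x / 3⌋₊ : ℕ) := by exact_mod_cast h1
  exact ⟨h1, h2, by linarith⟩

namespace ArmBounds

variable {C α : ℝ} (H : ArmBounds d C α)
include H

lemma arm_floor_third_le {x : ℝ} (hx : 3 ≤ x) :
    arm₂ d 1 ⌊x / 3⌋₊ ≤ C * ((6 : ℕ) : ℝ) ^ α * arm d x := by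
  obtain ⟨h1, h2, h3⟩ := floor_third_bounds hx
  refine H.le_of_le_mul (by norm_num) h1 (Nat.le_floor (by push_cast; linarith)) ?_
  have h4 := Nat.floor_le (by linarith : 0 ≤ x)
  exact_mod_cast h4.trans h3

/-- A parameter `s` of order `y ^ d / (n ^ d π(n / y))` at which `(1 + s) ^ |V_n|` has expectation
at most `exp (const · y ^ d)`: about `y ^ d` boxes of radius of order `n / y` fit into `Λ_n`. -/
lemma exists_genFun_le_exp : ∃ θ : ℝ, 0 < θ ∧ ∀ (n : ℕ) (y : ℝ), 1 ≤ y → 3 ≤ n / y →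
    ∃ s : ℝ, 0 < s ∧ s ≤ 1 ∧ genFun d n s ≤ Real.exp (18 ^ d * y ^ d) ∧
      θ * y ^ d ≤ s * ((n : ℝ) ^ d * arm d (n / y)) := by
  obtain ⟨θ, hθ0, hθ⟩ := H.exists_genFun_le_two_pow
  have hC : 0 < C := by linarith [H.one_le]
  refine ⟨θ / (C * ((6 : ℕ) : ℝ) ^ α), by positivity, fun n y hy hx => ?_⟩
  have hy0 : 0 < y := by linarith
  obtain ⟨hr1, hr2, hr3⟩ := floor_third_bounds hx
  have harm := H.arm_floor_third_le hx
  set r := ⌊(n : ℝ) / y / 3⌋₊ with hr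
  have hr0 : (0 : ℝ) < r := by exact_mod_cast hr1
  have hxn : (n : ℝ) / y ≤ n := div_le_self (Nat.cast_nonneg n) hy
  have hrn : 3 * r ≤ n := by
    have : (3 : ℝ) * r ≤ n := by linarith
    exact_mod_cast this
  obtain ⟨hs1, hs⟩ := hθ n r hr1 hrn
  have ha := H.pos r hr1
  refine ⟨θ / ((r : ℝ) ^ d * arm₂ d 1 r), by positivity, hs1, hs.trans ?_, ?_⟩
  · calc (2 : ℝ) ^ (2 * (n / r) + 1) ^ d ≤ Real.exp 1 ^ (2 * (n / r) + 1) ^ d := by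
          gcongr; exact two_le_exp_one
      _ = Real.exp (((2 * (n / r) + 1) ^ d : ℕ) : ℝ) := by rw [← Real.exp_nat_mul, mul_one]
      _ ≤ _ := by
        rw [Real.exp_le_exp, ← mul_pow]
        push_cast
        have h1 : ((n / r : ℕ) : ℝ) ≤ (n : ℝ) / r := Nat.cast_div_le
        have h2 : (n : ℝ) / r ≤ 6 * y := by
          rw [div_le_iff₀ hr0]
          rw [div_le_iff₀ hy0] at hr3
          linarith
        gcongr
        linarith
  · have h1 : (r : ℝ) * y ≤ n := by
      have : (r : ℝ) ≤ n / y := by linarith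
      rwa [le_div_iff₀ hy0] at this
    have h2 : ((r : ℝ) * y) ^ d ≤ (n : ℝ) ^ d := by gcongr
    have h6 : (0 : ℝ) < ((6 : ℕ) : ℝ) ^ α := by positivity
    rw [div_mul_eq_mul_div, div_mul_eq_mul_div, div_le_div_iff₀ (by positivity) (by positivity)]
    calc θ * y ^ d * ((r : ℝ) ^ d * arm₂ d 1 r) = θ * ((r : ℝ) * y) ^ d * arm₂ d 1 r := by
          rw [mul_pow]; ring
      _ ≤ θ * (n : ℝ) ^ d * (C * ((6 : ℕ) : ℝ) ^ α * arm d (n / y)) := by gcongr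
      _ = _ := by ring

/-- Factorial moments of all orders, uniformly in `k`. -/
lemma exists_integral_choose_le (hd : 1 ≤ d) : ∃ c : ℝ, 0 < c ∧ ∀ n k : ℕ, 1 ≤ n → 1 ≤ k →
    ∫ ω, (((V d n ω).ncard.choose k : ℕ) : ℝ) ∂(critical d) ≤
      (c * (n : ℝ) ^ d * arm d (n / (k : ℝ) ^ ((1 : ℝ) / d)) / k) ^ k := by
  obtain ⟨θ, hθ0, hθ⟩ := H.exists_genFun_le_exp
  have ha2 := H.pos 2 (by norm_num)
  have ha0 := arm₂_one_zero_pos hd ha2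
  set a := min (arm₂ d 1 0) (arm₂ d 1 2) with ha
  have ha' : 0 < a := lt_min ha0 ha2
  refine ⟨Real.exp (18 ^ d) / θ + Real.exp (3 ^ d) / a, by positivity, fun n k hn hk => ?_⟩
  have hn0 : (0 : ℝ) < n := by exact_mod_cast hn
  have hk1 : (1 : ℝ) ≤ k := by exact_mod_cast hk
  have hk0 : (0 : ℝ) < k := by linarith
  set y : ℝ := (k : ℝ) ^ ((1 : ℝ) / d) with hy
  have hy1 : 1 ≤ y := Real.one_le_rpow hk1 (by positivity)
  have hyd : y ^ d = k := by
    rw [hy, one_div, Real.rpow_inv_natCast_pow hk0.le (by omega)]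
  have harm0 : 0 ≤ arm d (n / y) := arm₂_nonneg _ _
  simp only [ncard_V]
  have hint : Integrable (fun ω : Config d =>
      (((exitSet (0 : Fin d → ℤ) n ω).card.choose k : ℕ) : ℝ)) (critical d) :=
    integrable_exitSet 0 n fun E => ((E.card.choose k : ℕ) : ℝ)
  rcases le_or_gt 3 ((n : ℝ) / y) with hx | hx
  · obtain ⟨s, hs0, hs1, hs, hsl⟩ := hθ n y hy1 hx
    rw [hyd] at hs hsl
    have hsinv : s⁻¹ ≤ (n : ℝ) ^ d * arm d (n / y) / (θ * k) := by
      rw [inv_le_iff_one_le_mul₀ hs0, div_mul_eq_mul_div, le_div_iff₀ (by positivity)]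
      linarith
    have hg : 0 ≤ genFun d n s := zero_le_one.trans (one_le_genFun n hs0.le)
    calc _ ≤ ∫ ω, (s⁻¹) ^ k * (1 + s) ^ (exitSet (0 : Fin d → ℤ) n ω).card ∂(critical d) :=
          integral_mono hint (integrable_exitSet 0 n fun E => (s⁻¹) ^ k * (1 + s) ^ E.card)
            fun ω => choose_le_pow_mul hs0 _ k
      _ = (s⁻¹) ^ k * genFun d n s := integral_const_mul _ _
      _ ≤ ((n : ℝ) ^ d * arm d (n / y) / (θ * k)) ^ k * Real.exp (18 ^ d * k) := by gcongr
      _ = (Real.exp (18 ^ d) / θ * (n : ℝ) ^ d * arm d (n / y) / k) ^ k := by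
          rw [mul_comm (18 ^ d : ℝ), Real.exp_nat_mul, ← mul_pow]
          congr 1
          field_simp
      _ ≤ _ := by
          gcongr
          exact le_add_of_nonneg_right (by positivity)
  · -- here `k` is of order `n ^ d` and the trivial bound on `|V_n|` suffices
    have hax : a ≤ arm d (n / y) := by
      have hfl : ⌊(n : ℝ) / y⌋₊ ≤ 2 := by
        rw [← Nat.lt_succ_iff, Nat.floor_lt (by positivity)]
        exact_mod_cast hx
      rw [arm]
      rcases Nat.eq_zero_or_pos ⌊(n : ℝ) / y⌋₊ with h0 | h0
      · rw [h0]
        exact min_le_left _ _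
      · exact (min_le_right _ _).trans (arm₂_anti_right h0 hfl)
    have hpt : ∀ ω : Config d, (((exitSet (0 : Fin d → ℤ) n ω).card.choose k : ℕ) : ℝ) ≤
        (Real.exp (3 ^ d) * (n : ℝ) ^ d / k) ^ k := by
      intro ω
      set s : ℝ := k / (n : ℝ) ^ d with hs
      have hs0 : 0 < s := by positivity
      have hX : ((exitSet (0 : Fin d → ℤ) n ω).card : ℝ) ≤ (3 * n : ℝ) ^ d := by
        have h1 : ((exitSet (0 : Fin d → ℤ) n ω).card : ℝ) ≤ ((2 * n + 1) ^ d : ℕ) := by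
          exact_mod_cast card_exitSet_le n 0 ω
        refine h1.trans ?_
        push_cast
        have : (1 : ℝ) ≤ n := by exact_mod_cast hn
        gcongr
        linarith
      calc _ ≤ (s⁻¹) ^ k * (1 + s) ^ (exitSet (0 : Fin d → ℤ) n ω).card :=
            choose_le_pow_mul hs0 _ k
        _ ≤ (s⁻¹) ^ k * Real.exp s ^ (exitSet (0 : Fin d → ℤ) n ω).card := by
            gcongr
            linarith [Real.add_one_le_exp s]
        _ ≤ (s⁻¹) ^ k * Real.exp (k * 3 ^ d) := by
            rw [← Real.exp_nat_mul]
            refine mul_le_mul_of_nonneg_left (Real.exp_le_exp.2 ?_) (by positivity)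
            calc _ ≤ (3 * n : ℝ) ^ d * s := by gcongr
              _ = k * 3 ^ d := by
                rw [hs, mul_pow]
                field_simp
        _ = _ := by
            rw [Real.exp_nat_mul, ← mul_pow, hs, inv_div]
            congr 1
            ring
    calc _ ≤ ∫ _ω : Config d, (Real.exp (3 ^ d) * (n : ℝ) ^ d / k) ^ k ∂(critical d) :=
          integral_mono hint (integrable_const _) hpt
      _ = (Real.exp (3 ^ d) * (n : ℝ) ^ d / k) ^ k := by simp
      _ ≤ _ := by
          refine pow_le_pow_left₀ (by positivity) (div_le_div_of_nonneg_right ?_ hk0.le) k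
          calc Real.exp (3 ^ d) * (n : ℝ) ^ d = Real.exp (3 ^ d) / a * (n : ℝ) ^ d * a := by
                field_simp
            _ ≤ (Real.exp (18 ^ d) / θ + Real.exp (3 ^ d) / a) * (n : ℝ) ^ d *
                arm d (n / y) := by
                gcongr
                exact le_add_of_nonneg_left (by positivity)

/-- The tail bound, with `exp 1` and `1` as the constants outside and inside the exponential. -/
lemma exists_tail_le : ∃ c : ℝ, 0 < c ∧ ∀ (n : ℕ) (u : ℝ), 1 ≤ n → 0 < u → u ≤ n →
    (critical d).real {ω | c * ((n : ℝ) ^ d * arm d (n / u)) ≤ ((V d n ω).ncard : ℝ)} ≤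
      Real.exp 1 * Real.exp (-1 * u ^ d) := by
  obtain ⟨θ, hθ0, hθ⟩ := H.exists_genFun_le_exp
  have ha2 := H.pos 2 (by norm_num)
  set c : ℝ := 2 * (18 ^ d + 1) / θ + (3 ^ d + 1) / arm₂ d 1 2 with hc
  have hc0 : 0 < c := by positivity
  refine ⟨c, hc0, fun n u hn hu hun => ?_⟩
  have hn0 : (0 : ℝ) < n := by exact_mod_cast hn
  have hn1 : (1 : ℝ) ≤ n := by exact_mod_cast hn
  simp only [ncard_V]
  rcases lt_or_ge u 1 with hu1 | hu1
  · refine measureReal_le_one.trans ?_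
    rw [← Real.exp_add, Real.one_le_exp_iff]
    have : u ^ d ≤ 1 := pow_le_one₀ hu.le hu1.le
    linarith
  rcases le_or_gt 3 ((n : ℝ) / u) with hx | hx
  · obtain ⟨s, hs0, hs1, hs, hsl⟩ := hθ n u hu1 hx
    set z : ℝ := c * ((n : ℝ) ^ d * arm d (n / u)) with hz
    have harm0 : 0 ≤ arm d (n / u) := arm₂_nonneg _ _
    have hsz : (18 ^ d + 1) * u ^ d ≤ s / 2 * z := by
      calc (18 ^ d + 1) * u ^ d = (18 ^ d + 1) / θ * (θ * u ^ d) := by field_simp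
        _ ≤ (18 ^ d + 1) / θ * (s * ((n : ℝ) ^ d * arm d (n / u))) := by gcongr
        _ = s / 2 * ((2 * (18 ^ d + 1) / θ) * ((n : ℝ) ^ d * arm d (n / u))) := by ring
        _ ≤ _ := by
          rw [hz]
          gcongr
          exact le_add_of_nonneg_right (by positivity)
    -- Chernoff's bound
    have hmarkov := mul_meas_ge_le_integral_of_nonneg (μ := critical d)
      (f := fun ω => (1 + s) ^ (exitSet (0 : Fin d → ℤ) n ω).card)
      (Filter.Eventually.of_forall fun ω => by positivity)
      (integrable_exitSet 0 n fun E => (1 + s) ^ E.card) (Real.exp (s / 2 * z))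
    have hsub : (critical d).real {ω | z ≤ ((exitSet (0 : Fin d → ℤ) n ω).card : ℝ)} ≤
        (critical d).real {ω | Real.exp (s / 2 * z) ≤
          (1 + s) ^ (exitSet (0 : Fin d → ℤ) n ω).card} := by
      refine measureReal_mono fun ω hω => ?_
      have hω' : z ≤ ((exitSet (0 : Fin d → ℤ) n ω).card : ℝ) := hω
      calc Real.exp (s / 2 * z) ≤ Real.exp ((exitSet (0 : Fin d → ℤ) n ω).card * (s / 2)) := by
            rw [Real.exp_le_exp, mul_comm]
            gcongr
        _ = Real.exp (s / 2) ^ (exitSet (0 : Fin d → ℤ) n ω).card := Real.exp_nat_mul _ _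
        _ ≤ _ := by
            gcongr
            exact exp_half_mul_le hs0.le hs1
    have hP : (critical d).real {ω | Real.exp (s / 2 * z) ≤
        (1 + s) ^ (exitSet (0 : Fin d → ℤ) n ω).card} ≤
        Real.exp (18 ^ d * u ^ d) / Real.exp (s / 2 * z) := by
      rw [le_div_iff₀ (Real.exp_pos _), mul_comm]
      exact hmarkov.trans hs
    refine (hsub.trans hP).trans ?_
    rw [← Real.exp_sub, ← Real.exp_add, Real.exp_le_exp]
    linarith
  · -- here the threshold exceeds the number of vertices of the box
    have hax : arm₂ d 1 2 ≤ arm d (n / u) := by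
      have hfl : ⌊(n : ℝ) / u⌋₊ ≤ 2 := by
        rw [← Nat.lt_succ_iff, Nat.floor_lt (by positivity)]
        exact_mod_cast hx
      have hfl1 : 1 ≤ ⌊(n : ℝ) / u⌋₊ := Nat.le_floor (by
        push_cast
        rwa [one_le_div hu])
      exact arm₂_anti_right hfl1 hfl
    have hempty : {ω : Config d | c * ((n : ℝ) ^ d * arm d (n / u)) ≤
        ((exitSet (0 : Fin d → ℤ) n ω).card : ℝ)} = ∅ := by
      refine Set.eq_empty_of_forall_notMem fun ω hω => ?_
      have h1 : ((exitSet (0 : Fin d → ℤ) n ω).card : ℝ) ≤ ((2 * n + 1) ^ d : ℕ) := by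
        exact_mod_cast card_exitSet_le n 0 ω
      have h2 : (((2 * n + 1) ^ d : ℕ) : ℝ) ≤ 3 ^ d * (n : ℝ) ^ d := by
        rw [← mul_pow]
        push_cast
        gcongr
        linarith
      have h3 : (3 ^ d + 1) * (n : ℝ) ^ d ≤ c * ((n : ℝ) ^ d * arm d (n / u)) := by
        calc (3 ^ d + 1) * (n : ℝ) ^ d =
            (3 ^ d + 1) / arm₂ d 1 2 * ((n : ℝ) ^ d * arm₂ d 1 2) := by field_simp
          _ ≤ _ := by
            rw [hc]
            gcongr
            exact le_add_of_nonneg_left (by positivity)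
      have h4 : (0 : ℝ) < (n : ℝ) ^ d := by positivity
      have h5 : c * ((n : ℝ) ^ d * arm d (n / u)) ≤
        ((exitSet (0 : Fin d → ℤ) n ω).card : ℝ) := hω
      linarith
    rw [hempty, measureReal_empty]
    positivity

end ArmBounds
/-- Under one-arm decay, `π(m)` drops below any fixed fraction when the scale grows by a suitable
constant factor. -/
lemma OneArmDecay.iterate {L : ℕ} {q : ℝ} (h : OneArmDecay d L q) (hL : 1 ≤ L) (hq : 0 ≤ q)
    (j m : ℕ) (hm : 1 ≤ m) : arm₂ d 1 (L ^ j * m) ≤ q ^ j * arm₂ d 1 m := by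
  induction j with
  | zero => simp
  | succ j ih =>
    have h1 := h (L ^ j * m) (Nat.mul_pos (pow_pos hL j) hm)
    rw [arm_natCast, arm_natCast] at h1
    calc arm₂ d 1 (L ^ (j + 1) * m) = arm₂ d 1 (L * (L ^ j * m)) := by
          congr 1
          ring
      _ ≤ q * arm₂ d 1 (L ^ j * m) := h1
      _ ≤ q * (q ^ j * arm₂ d 1 m) := by gcongr
      _ = _ := by ring

/-- Enlarging the scale `n / u` by a constant factor makes the threshold smaller by any prescribed
factor, at the cost of a constant factor in front of `u ^ d`. -/
lemma ArmBounds.exists_tail_le_of_decay {C α : ℝ} (H : ArmBounds d C α) {L : ℕ} {q : ℝ}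
    (hL : 2 ≤ L) (hq : q < 1) (hdec : OneArmDecay d L q) :
    ∃ c₃ : ℝ, 0 < c₃ ∧ ∀ (n : ℕ) (u : ℝ), 1 ≤ n → 0 < u → u ≤ n →
      (critical d).real {ω | (n : ℝ) ^ d * arm d (n / u) ≤ ((V d n ω).ncard : ℝ)} ≤
        Real.exp 1 * Real.exp (-c₃ * u ^ d) := by
  obtain ⟨c, hc0, hc⟩ := H.exists_tail_le
  have hq0 : 0 ≤ q := by
    have h1 := hdec 1 le_rfl
    rw [arm_natCast, arm_natCast, H.arm₂_one_one] at h1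
    have := arm₂_nonneg (d := d) 1 (L * 1)
    linarith
  obtain ⟨j, hj⟩ := exists_pow_lt_of_lt_one (inv_pos.2 hc0) hq
  have hB1 : (1 : ℝ) ≤ (L : ℝ) ^ j := one_le_pow₀ (by
    have : (2 : ℝ) ≤ L := by exact_mod_cast hL
    linarith)
  have hB0 : (0 : ℝ) < (L : ℝ) ^ j := by linarith
  refine ⟨(((L : ℝ) ^ j) ^ d)⁻¹, by positivity, fun n u hn hu hun => ?_⟩
  have hn0 : (0 : ℝ) < n := by exact_mod_cast hn
  have h1 := hc n (u / (L : ℝ) ^ j) hn (by positivity) ((div_le_self hu.le hB1).trans hun)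
  have hm : 1 ≤ ⌊(n : ℝ) / u⌋₊ := Nat.le_floor (by
    push_cast
    rwa [one_le_div hu])
  have harm : c * arm d (n / (u / (L : ℝ) ^ j)) ≤ arm d (n / u) := by
    have h2 : L ^ j * ⌊(n : ℝ) / u⌋₊ ≤ ⌊(n : ℝ) / (u / (L : ℝ) ^ j)⌋₊ := by
      refine Nat.le_floor ?_
      have h3 := Nat.floor_le (by positivity : 0 ≤ (n : ℝ) / u)
      push_cast
      calc (L : ℝ) ^ j * (⌊(n : ℝ) / u⌋₊ : ℕ) ≤ (L : ℝ) ^ j * (n / u) := by gcongr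
        _ = _ := by field_simp
    have h3 : 1 ≤ L ^ j * ⌊(n : ℝ) / u⌋₊ := Nat.mul_pos (pow_pos (by omega) j) hm
    have h4 := OneArmDecay.iterate hdec (by omega) hq0 j _ hm
    have h5 := arm₂_nonneg (d := d) 1 ⌊(n : ℝ) / u⌋₊
    calc c * arm d (n / (u / (L : ℝ) ^ j)) ≤ c * (c⁻¹ * arm₂ d 1 ⌊(n : ℝ) / u⌋₊) := by
          gcongr
          exact (arm₂_anti_right h3 h2).trans (h4.trans (by gcongr))
      _ = arm d (n / u) := by rw [mul_inv_cancel_left₀ hc0.ne']; rfl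
  have h6 : (critical d).real {ω | (n : ℝ) ^ d * arm d (n / u) ≤ ((V d n ω).ncard : ℝ)} ≤
      (critical d).real {ω | c * ((n : ℝ) ^ d * arm d (n / (u / (L : ℝ) ^ j))) ≤
        ((V d n ω).ncard : ℝ)} := by
    refine measureReal_mono fun ω hω => ?_
    rw [Set.mem_ofPred_eq] at hω ⊢
    refine le_trans ?_ hω
    have := mul_le_mul_of_nonneg_left harm (by positivity : 0 ≤ (n : ℝ) ^ d)
    linarith
  refine (h6.trans h1).trans_eq ?_
  rw [div_pow]
  congr 2
  field_simp

end BondPercolation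

end

theorem theorem2 (d : ℕ) (hd : 2 ≤ d) (C₁ C₂ α : ℝ) (hC₂ : 0 < C₂) (hα : α < d) :
    (∃ c₁ c₂ c₃ c₄ : ℝ, 0 < c₁ ∧ 0 < c₂ ∧ 0 < c₃ ∧ 0 < c₄ ∧
      (BondPercolation.QuasiMultiplicative d C₁ → BondPercolation.OneArmLowerBound d C₂ α →
        (∀ n k : ℕ, 1 ≤ n → 1 ≤ k →
          Integrable (fun ω => (((BondPercolation.V d n ω).ncard.choose k : ℕ) : ℝ))
            (BondPercolation.critical d) ∧
          ∫ ω, (((BondPercolation.V d n ω).ncard.choose k : ℕ) : ℝ) ∂(BondPercolation.critical d) ≤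
            (c₁ * (n : ℝ) ^ d * BondPercolation.arm d (n / (k : ℝ) ^ ((1 : ℝ) / d)) / k) ^ k) ∧
        (∀ (n : ℕ) (u : ℝ), 1 ≤ n → 0 < u → u ≤ n →
          (BondPercolation.critical d).real
              {ω | c₄ * ((n : ℝ) ^ d * BondPercolation.arm d (n / u)) ≤
                ((BondPercolation.V d n ω).ncard : ℝ)} ≤
            c₂ * Real.exp (-c₃ * u ^ d)))) ∧
    (∀ (L : ℕ) (q : ℝ), 2 ≤ L → q < 1 → ∃ c₂ c₃ : ℝ, 0 < c₂ ∧ 0 < c₃ ∧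
      (BondPercolation.QuasiMultiplicative d C₁ → BondPercolation.OneArmLowerBound d C₂ α →
        BondPercolation.OneArmDecay d L q →
        ∀ (n : ℕ) (u : ℝ), 1 ≤ n → 0 < u → u ≤ n →
          (BondPercolation.critical d).real
              {ω | (n : ℝ) ^ d * BondPercolation.arm d (n / u) ≤
                ((BondPercolation.V d n ω).ncard : ℝ)} ≤
            c₂ * Real.exp (-c₃ * u ^ d))) := by
  -- the constants are immaterial if the hypotheses fail
  by_cases hyp : BondPercolation.QuasiMultiplicative d C₁ ∧
      BondPercolation.OneArmLowerBound d C₂ α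
  · obtain ⟨C, α', H⟩ := BondPercolation.exists_armBounds hd hC₂ hα hyp.1 hyp.2
    constructor
    · obtain ⟨c₁, hc₁, h₁⟩ := H.exists_integral_choose_le (by omega)
      obtain ⟨c₄, hc₄, h₄⟩ := H.exists_tail_le
      refine ⟨c₁, Real.exp 1, 1, c₄, hc₁, Real.exp_pos 1, one_pos, hc₄, fun _ _ =>
        ⟨fun n k hn hk => ⟨?_, h₁ n k hn hk⟩, h₄⟩⟩
      simp only [BondPercolation.ncard_V]
      exact BondPercolation.integrable_exitSet 0 n fun E => ((E.card.choose k : ℕ) : ℝ)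
    · intro L q hL hq
      by_cases hdec : BondPercolation.OneArmDecay d L q
      · obtain ⟨c₃, hc₃, h₃⟩ := H.exists_tail_le_of_decay hL hq hdec
        exact ⟨Real.exp 1, c₃, Real.exp_pos 1, hc₃, fun _ _ _ => h₃⟩
      · exact ⟨1, 1, one_pos, one_pos, fun _ _ h => absurd h hdec⟩
  · exact ⟨⟨1, 1, 1, 1, one_pos, one_pos, one_pos, one_pos, fun h1 h2 => absurd ⟨h1, h2⟩ hyp⟩,
      fun _ _ _ _ => ⟨1, 1, one_pos, one_pos, fun h1 h2 => absurd ⟨h1, h2⟩ hyp⟩⟩
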